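/- **Setting.** Let $N_T,N_I,N_R\ge 1$. A reciprocal lossy $(N_T+N_I+N_R)$-port network is given by a complex symmetric admittance matrix $\mathbf Y=(\mathbf Y_{ab})_{a,b\in\{T,I,R\}}$ with $\mathcal R(\mathbf Y)\succ 0$, a diagonal load admittance matrix $\mathbf Y_R$ whose diagonal entries have positive real part, and a reference admittance $Y_0>0$. Put $\mathbf M=\mathbf Y_R+\mathbf Y_{RR}$, $\bar{\mathbf Y}_{II}=\mathbf Y_{II}-\mathbf Y_{IR}\mathbf M^{-1}\mathbf Y_{RI}$, $\mathbf R=\mathcal R(\bar{\mathbf Y}_{II})$, and $$\bar{\mathbf Y}_{RT}=2Y_0\mathbf M^{-1}\mathbf Y_{RT},\quad \bar{\mathbf Y}_{RI}=\sqrt2Y_0\mathbf M^{-1}\mathbf Y_{RI}\mathbf R^{-1/2},\quad \bar{\mathbf Y}_{IT}=\sqrt2Y_0\mathbf R^{-1/2}(\mathbf Y_{IT}-\mathbf Y_{IR}\mathbf M^{-1}\mathbf Y_{RT}),$$ $$\bar{\mathbf H}_{RT}=-\tfrac1{2Y_0}\bigl(\bar{\mathbf Y}_{RT}-\tfrac1{2Y_0}\bar{\mathbf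 Y}_{RI}\bar{\mathbf Y}_{IT}\bigr),\quad \bar{\mathbf H}_{RI}=-\tfrac{1}{2Y_0}\bar{\mathbf Y}_{RI},\quad \bar{\mathbf H}_{IT}=-\tfrac1{2Y_0}\bar{\mathbf Y}_{IT}.$$ For a graph $G$ on the $N_I$ RIS elements let $\mathcal B$ be the set of real symmetric matrices $\mathbf B$ with $[\mathbf B]_{i,j}=0$ for all distinct non-adjacent $i,j$. The RIS is fully-connected ($G$ complete) or tree-connected ($G$ a tree, e.g. a path, which gives the tridiagonal matrices). A configuration is a triple $(\bar{\boldsymbol\Theta},\bar{\mathbf B}_I,\mathbf B_I)$ with $\mathbf B_I\in\mathcal B$ and $$\bar{\mathbf B}_I=Y_0\mathbf R^{-1/2}(\mathbf B_I+\mathcal I(\bar{\mathbf Y}_{II}))\mathbf R^{-1/2},\qquad \bar{\boldsymbol\Theta}=(Y_0\mathbf I+\mathrm i\bar{\mathbf B}_I)^{-1}(Y_0\mathbf I-\mathrm i\bar{\mathbf B}_I).$$ Let $P_T>0$ and consider * (P) maximize $P_T|\mathbf g^H(\bar{\mathbf H}_{RT}+\bar{\mathbf H}_{RI}\bar{\boldsymbol\Theta}\bar{\mathbf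 H}_{IT})\mathbf w|^2$ over configurations and $\|\mathbf w\|_2=\|\mathbf g\|_2=1$; * (R) maximize $\|\bar{\mathbf H}_{RT}\mathbf w+\bar{\mathbf H}_{RI}\mathbf u\|_2^2$ subject to $\|\mathbf u\|_2=\|\bar{\mathbf H}_{IT}\mathbf w\|_2$, $\|\mathbf w\|_2=1$; * (SDP) maximize $\mathrm{tr}(\mathbf Q_0\mathbf X)$ over complex $\mathbf X\succeq0$ of order $N_T+N_I$ with $\mathrm{tr}(\mathbf Q_1\mathbf X)=0$, $\mathrm{tr}(\mathbf Q_2\mathbf X)=1$, where $\mathbf Q_0=[\bar{\mathbf H}_{RT}\ \bar{\mathbf H}_{RI}]^H[\bar{\mathbf H}_{RT}\ \bar{\mathbf H}_{RI}]$, $\mathbf Q_1=\mathrm{blkdiag}(\bar{\mathbf H}_{IT}^H\bar{\mathbf H}_{IT},-\mathbf I)$, $\mathbf Q_2=\mathrm{blkdiag}(\mathbf I,\mathbf 0)$. **Claim.** 1. (R) and (SDP) attain their maxima, these have a common value $P_u$, and the supremum of (P) is $P_TP_u$. 2. The SDR is tight: (SDP) has an optimal solution of rank one; every rank-one optimal solution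 is $\mathbf x\mathbf x^H$ for some $\mathbf x$, and for each such $\mathbf x=[\mathbf w^T,\mathbf u^T]^T$ the pair $(\mathbf w,\mathbf u)$ is optimal for (R). 3. A feasible point of (P) is optimal if and only if $(\mathbf w,\bar{\boldsymbol\Theta}\bar{\mathbf H}_{IT}\mathbf w)$ is optimal for (R) and $|\mathbf g^H\mathbf H\mathbf w|=\|\mathbf H\mathbf w\|_2$, where $\mathbf H=\bar{\mathbf H}_{RT}+\bar{\mathbf H}_{RI}\bar{\boldsymbol\Theta}\bar{\mathbf H}_{IT}$. If $(\mathbf w^*,\mathbf u^*)$ is optimal for (R) and a configuration satisfies $\mathbf u^*=\bar{\boldsymbol\Theta}\bar{\mathbf H}_{IT}\mathbf w^*$, then with some $\mathbf g$ it gives an optimal solution of (P), of value $P_T\|\bar{\mathbf H}_{RT}\mathbf w^*+\bar{\mathbf H}_{RI}\mathbf u^*\|_2^2$. 4. (Recovery.) Let $(\mathbf w,\mathbf u)$ be feasible for (R), in particular an optimal solution, and $\mathbf a=\bar{\mathbf H}_{IT}\mathbf w$. (a) If $G$ is a tree, exactly one configuration satisfies $\mathbf u=\bar{\boldsymbol\Theta}\mathbf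 a$ if and only if $\mathbf p=\mathbf R^{-1/2}(\mathbf u+\mathbf a)$ is non-degenerate: $p_i\neq0$ for all $i$ and $\mathcal I(\overline{p_i}\,p_j)\ne0$ for all adjacent $i,j$. (b) If $G$ is complete, some configuration satisfies $\mathbf u=\bar{\boldsymbol\Theta}\mathbf a$ if and only if for every $c\in\mathbb C$, $\mathcal R(c(\mathbf u+\mathbf a))=\mathbf 0$ implies $\mathcal I(c(\mathbf u-\mathbf a))=\mathbf 0$ (for instance, if $\mathcal R(\mathbf u+\mathbf a)$ and $\mathcal I(\mathbf u+\mathbf a)$ are linearly independent over $\mathbb R$). (c) In both cases, for every $\varepsilon>0$ some configuration satisfies $\|\mathbf u-\bar{\boldsymbol\Theta}\mathbf a\|_2<\varepsilon$. 5. (Low-dimensional SDR.) Let $N_R\le N_I$, let $\bar{\mathbf H}_{RI}=\mathbf U\mathbf D\mathbf V^H$ be a singular value decomposition with singular values in descending order, and let $\bar{\mathbf D}$ consist of the first $N_R$ columns of $\mathbf D$. Let (R$'$) be the problem of maximizing $\|\mathbf U^H\bar{\mathbf H}_{RT}\mathbf w+\mathbf D\hat{\mathbf u}\|_2^2$ subject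 to $\|\hat{\mathbf u}\|_2=\|\bar{\mathbf H}_{IT}\mathbf w\|_2$, $\|\mathbf w\|_2=1$, and (R$''$) the same problem with $\bar{\mathbf D}$ and $\bar{\mathbf u}\in\mathbb C^{N_R}$ in place of $\mathbf D$ and $\hat{\mathbf u}$. Then $(\mathbf w,\mathbf u)$ is optimal for (R) iff $(\mathbf w,\mathbf V^H\mathbf u)$ is optimal for (R$'$). If $\bar{\mathbf H}_{RI}\neq\mathbf 0$, every optimal solution of (R$'$) has $[\hat{\mathbf u}]_i=0$ for $i>N_R$. A pair $(\mathbf w,\bar{\mathbf u})$ is optimal for (R$''$) iff $(\mathbf w,\mathbf V[\bar{\mathbf u}^T,\mathbf 0^T]^T)$ is optimal for (R). The SDR of (R$''$), a semidefinite program of order $N_T+N_R$, is tight in the sense of item 2. -/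

import Mathlib

open scoped Matrix ComplexOrder

noncomputable section

namespace RIS

/-! ### Vectors, square roots and optimization problems -/

/-- The Euclidean norm of a complex vector. -/
def l2 {ι : Type*} [Fintype ι] (v : ι → ℂ) : ℝ := ‖(WithLp.toLp 2 v : EuclideanSpace ℂ ι)‖

/-- The inverse square root of a (positive definite) real symmetric matrix, by the
functional calculus. -/
def invSqrt {n : ℕ} (A : Matrix (Fin n) (Fin n) ℝ) : Matrix (Fin n) (Fin n) ℝ :=
  cfc (fun x : ℝ => (Real.sqrt x)⁻¹) A

/-- `x` is a (global) optimal solution of: maximize `f` over `S`. -/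
def IsOptimal {α : Type*} (S : Set α) (f : α → ℝ) (x : α) : Prop :=
  x ∈ S ∧ ∀ y ∈ S, f y ≤ f x

/-- A real matrix seen as a complex one. -/
def toC {m n : ℕ} (A : Matrix (Fin m) (Fin n) ℝ) : Matrix (Fin m) (Fin n) ℂ :=
  A.map Complex.ofReal

/-! ### The multiport network -/

/-- A reciprocal lossy `(NT + NI + NR)`-port network given by its admittance matrix `Y`, with the
ports ordered as transmitter, RIS, receiver, the load admittances `yR` of the receive antennas and
the reference admittance `Y0`. -/
structure Network (NT NI NR : ℕ) where
  Y : Matrix (Fin NT ⊕ Fin NI ⊕ Fin NR) (Fin NT ⊕ Fin NI ⊕ Fin NR) ℂ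
  yR : Fin NR → ℂ
  Y0 : ℝ
  symm : Yᵀ = Y
  re_posDef : (Y.map Complex.re).PosDef
  yR_re_pos : ∀ i, 0 < (yR i).re
  Y0_pos : 0 < Y0

namespace Network

variable {NT NI NR : ℕ} (net : Network NT NI NR)

def YII : Matrix (Fin NI) (Fin NI) ℂ := fun i j => net.Y (.inr (.inl i)) (.inr (.inl j))
def YIT : Matrix (Fin NI) (Fin NT) ℂ := fun i j => net.Y (.inr (.inl i)) (.inl j)
def YIR : Matrix (Fin NI) (Fin NR) ℂ := fun i j => net.Y (.inr (.inl i)) (.inr (.inr j))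
def YRT : Matrix (Fin NR) (Fin NT) ℂ := fun i j => net.Y (.inr (.inr i)) (.inl j)
def YRI : Matrix (Fin NR) (Fin NI) ℂ := fun i j => net.Y (.inr (.inr i)) (.inr (.inl j))
def YRR : Matrix (Fin NR) (Fin NR) ℂ := fun i j => net.Y (.inr (.inr i)) (.inr (.inr j))

/-- `(Y_R + Y_RR)⁻¹`, with `Y_R` the diagonal matrix of the load admittances. -/
def loadInv : Matrix (Fin NR) (Fin NR) ℂ := (Matrix.diagonal net.yR + net.YRR)⁻¹

def barYII : Matrix (Fin NI) (Fin NI) ℂ := net.YII - net.YIR * net.loadInv * net.YRI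

/-- Real part of `barYII`. -/
def reYII : Matrix (Fin NI) (Fin NI) ℝ := net.barYII.map Complex.re

/-- Imaginary part of `barYII`. -/
def imYII : Matrix (Fin NI) (Fin NI) ℝ := net.barYII.map Complex.im

def barYRT : Matrix (Fin NR) (Fin NT) ℂ := (2 * net.Y0 : ℂ) • (net.loadInv * net.YRT)

def barYRI : Matrix (Fin NR) (Fin NI) ℂ :=
  ((Real.sqrt 2 * net.Y0 : ℝ) : ℂ) • (net.loadInv * net.YRI * toC (invSqrt net.reYII))

def barYIT : Matrix (Fin NI) (Fin NT) ℂ :=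
  ((Real.sqrt 2 * net.Y0 : ℝ) : ℂ) •
    (toC (invSqrt net.reYII) * (net.YIT - net.YIR * net.loadInv * net.YRT))

def HRT : Matrix (Fin NR) (Fin NT) ℂ :=
  (-(1 / (2 * net.Y0)) : ℂ) • (net.barYRT - (1 / (2 * net.Y0) : ℂ) • (net.barYRI * net.barYIT))

def HRI : Matrix (Fin NR) (Fin NI) ℂ := (-(1 / (2 * net.Y0)) : ℂ) • net.barYRI

def HIT : Matrix (Fin NI) (Fin NT) ℂ := (-(1 / (2 * net.Y0)) : ℂ) • net.barYIT

/-- The virtual susceptance matrix that belongs to the susceptance matrix `B` of the RIS. -/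
def barB (B : Matrix (Fin NI) (Fin NI) ℝ) : Matrix (Fin NI) (Fin NI) ℝ :=
  net.Y0 • (invSqrt net.reYII * (B + net.imYII) * invSqrt net.reYII)

/-- The virtual scattering matrix that belongs to the virtual susceptance matrix `Bbar`. -/
def barTheta (Bbar : Matrix (Fin NI) (Fin NI) ℝ) : Matrix (Fin NI) (Fin NI) ℂ :=
  ((net.Y0 : ℂ) • (1 : Matrix (Fin NI) (Fin NI) ℂ) + Complex.I • toC Bbar)⁻¹ *
    ((net.Y0 : ℂ) • (1 : Matrix (Fin NI) (Fin NI) ℂ) - Complex.I • toC Bbar)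

/-- The channel matrix for the virtual scattering matrix `Θ`. -/
def channel (Θ : Matrix (Fin NI) (Fin NI) ℂ) : Matrix (Fin NR) (Fin NT) ℂ :=
  net.HRT + net.HRI * Θ * net.HIT

end Network

/-! ### RIS architectures -/

/-- Susceptance matrices of an RIS whose elements are interconnected along the edges of `G`.
The fully-connected RIS is `G = ⊤`; a tree-connected RIS is one where `G` is a tree. -/
def archSet {NI : ℕ} (G : SimpleGraph (Fin NI)) : Set (Matrix (Fin NI) (Fin NI) ℝ) :=
  {B | Bᵀ = B ∧ ∀ i j, i ≠ j → ¬ G.Adj i j → B i j = 0}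

/-- The variables that describe the RIS: virtual scattering matrix, virtual susceptance matrix,
susceptance matrix. -/
structure Config (NI : ℕ) where
  Θ : Matrix (Fin NI) (Fin NI) ℂ
  Bbar : Matrix (Fin NI) (Fin NI) ℝ
  B : Matrix (Fin NI) (Fin NI) ℝ

/-- The configurations that the network and the architecture `G` allow. -/
def Network.configs {NT NI NR : ℕ} (net : Network NT NI NR) (G : SimpleGraph (Fin NI)) :
    Set (Config NI) :=
  {t | t.Θ = net.barTheta t.Bbar ∧ t.Bbar = net.barB t.B ∧ t.B ∈ archSet G}

/-! ### Receive power maximization -/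

/-- All variables of the receive power maximization: RIS configuration, precoder, combiner. -/
structure Design (NT NI NR : ℕ) where
  ris : Config NI
  w : Fin NT → ℂ
  g : Fin NR → ℂ

namespace Network

variable {NT NI NR : ℕ} (net : Network NT NI NR)

def designs (G : SimpleGraph (Fin NI)) : Set (Design NT NI NR) :=
  {d | d.ris ∈ net.configs G ∧ l2 d.w = 1 ∧ l2 d.g = 1}

/-- The receive power `PT * |gᴴ (HRT + HRI Θ HIT) w|²`. -/
def power (PT : ℝ) (d : Design NT NI NR) : ℝ :=
  PT * ‖star d.g ⬝ᵥ (net.channel d.ris.Θ *ᵥ d.w)‖ ^ 2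

/-- The system for the recovery of an RIS configuration from `(w, u)`. -/
def recovery (G : SimpleGraph (Fin NI)) (w : Fin NT → ℂ) (u : Fin NI → ℂ) : Set (Config NI) :=
  {t | u = t.Θ *ᵥ (net.HIT *ᵥ w) ∧ t ∈ net.configs G}

/-- The vector `reYII^(-1/2) (u + HIT w)`. -/
def recoveryVec (w : Fin NT → ℂ) (u : Fin NI → ℂ) : Fin NI → ℂ :=
  toC (invSqrt net.reYII) *ᵥ (u + net.HIT *ᵥ w)

/-- No entry of `recoveryVec` vanishes, and entries at adjacent RIS elements are linearly
independent over the reals. -/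
def NonDegenerate (G : SimpleGraph (Fin NI)) (w : Fin NT → ℂ) (u : Fin NI → ℂ) : Prop :=
  (∀ i, net.recoveryVec w u i ≠ 0) ∧
    ∀ i j, G.Adj i j → (star (net.recoveryVec w u i) * net.recoveryVec w u j).im ≠ 0

end Network

/-! ### The relaxed problem and its semidefinite relaxation -/

section Relaxation

variable {NT NI NR k : ℕ}

/-- Feasible pairs `(w, u)`: `‖u‖ = ‖E w‖` and `‖w‖ = 1`. -/
def relaxSet (k : ℕ) (E : Matrix (Fin NI) (Fin NT) ℂ) : Set ((Fin NT → ℂ) × (Fin k → ℂ)) :=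
  {p | l2 p.2 = l2 (E *ᵥ p.1) ∧ l2 p.1 = 1}

/-- The objective `‖A w + C u‖²`. -/
def relaxObj (A : Matrix (Fin NR) (Fin NT) ℂ) (C : Matrix (Fin NR) (Fin k) ℂ)
    (p : (Fin NT → ℂ) × (Fin k → ℂ)) : ℝ :=
  l2 (A *ᵥ p.1 + C *ᵥ p.2) ^ 2

def Q0 (A : Matrix (Fin NR) (Fin NT) ℂ) (C : Matrix (Fin NR) (Fin k) ℂ) :
    Matrix (Fin NT ⊕ Fin k) (Fin NT ⊕ Fin k) ℂ :=
  Matrix.fromBlocks (Aᴴ * A) (Aᴴ * C) (Cᴴ * A) (Cᴴ * C)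

def Q1 (k : ℕ) (E : Matrix (Fin NI) (Fin NT) ℂ) : Matrix (Fin NT ⊕ Fin k) (Fin NT ⊕ Fin k) ℂ :=
  Matrix.fromBlocks (Eᴴ * E) 0 0 (-1)

def Q2 (NT k : ℕ) : Matrix (Fin NT ⊕ Fin k) (Fin NT ⊕ Fin k) ℂ :=
  Matrix.fromBlocks 1 0 0 0

/-- Feasible set of the semidefinite relaxation, a program in a matrix of order `NT + k`. -/
def sdpSet (k : ℕ) (E : Matrix (Fin NI) (Fin NT) ℂ) :
    Set (Matrix (Fin NT ⊕ Fin k) (Fin NT ⊕ Fin k) ℂ) :=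
  {X | X.PosSemidef ∧ (Q1 k E * X).trace = 0 ∧ (Q2 NT k * X).trace = 1}

/-- Objective `tr (Q0 X)` of the semidefinite relaxation (a real number for Hermitian `X`). -/
def sdpObj (A : Matrix (Fin NR) (Fin NT) ℂ) (C : Matrix (Fin NR) (Fin k) ℂ)
    (X : Matrix (Fin NT ⊕ Fin k) (Fin NT ⊕ Fin k) ℂ) : ℝ :=
  ((Q0 A C * X).trace).re

/-- The semidefinite relaxation is tight: it has an optimal solution of rank one, every optimal
solution `X` of rank one is of the form `x xᴴ`, and each such `x = (w, u)` is an optimal solution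
of the problem it relaxes. -/
def SDRTight (A : Matrix (Fin NR) (Fin NT) ℂ) (C : Matrix (Fin NR) (Fin k) ℂ)
    (E : Matrix (Fin NI) (Fin NT) ℂ) : Prop :=
  (∃ X, IsOptimal (sdpSet k E) (sdpObj A C) X ∧ X.rank = 1) ∧
    ∀ X, IsOptimal (sdpSet k E) (sdpObj A C) X → X.rank = 1 →
      (∃ x : Fin NT ⊕ Fin k → ℂ, X = Matrix.vecMulVec x (star x)) ∧
      ∀ x : Fin NT ⊕ Fin k → ℂ, X = Matrix.vecMulVec x (star x) →
        IsOptimal (relaxSet k E) (relaxObj A C) (x ∘ Sum.inl, x ∘ Sum.inr)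

end Relaxation

/-! ### Singular value decomposition -/

/-- The rectangular diagonal matrix with diagonal `σ`. -/
def rectDiag {m n : ℕ} (σ : Fin m → ℝ) : Matrix (Fin m) (Fin n) ℂ :=
  fun i j => if i.val = j.val then (σ i : ℂ) else 0

/-- `H = U D Vᴴ` is a singular value decomposition of an `m × n` matrix with `m ≤ n`, with the
singular values `σ` in descending order. -/
def IsSVD {m n : ℕ} (H : Matrix (Fin m) (Fin n) ℂ) (U : Matrix (Fin m) (Fin m) ℂ) (σ : Fin m → ℝ)
    (V : Matrix (Fin n) (Fin n) ℂ) : Prop :=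
  U ∈ Matrix.unitaryGroup (Fin m) ℂ ∧ V ∈ Matrix.unitaryGroup (Fin n) ℂ ∧
    (∀ i, 0 ≤ σ i) ∧ Antitone σ ∧ H = U * rectDiag σ * Vᴴ

/-- Extension of a vector by zeros. -/
def zeroPad {m : ℕ} (n : ℕ) (v : Fin m → ℂ) : Fin n → ℂ :=
  fun i => if h : i.val < m then v ⟨i.val, h⟩ else 0

end RIS


namespace RIS
/-- `invSqrt A` is the positive definite square root of `A⁻¹`. -/
theorem invSqrt_spec {n : ℕ} {A : Matrix (Fin n) (Fin n) ℝ} (hA : A.PosDef) :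
    (invSqrt A).PosDef ∧ invSqrt A * invSqrt A = A⁻¹ := by
  have hsa : IsSelfAdjoint A := hA.isHermitian.isSelfAdjoint
  have hpos : ∀ x ∈ spectrum ℝ A, 0 < x := by
    intro x hx
    rw [hA.isHermitian.spectrum_real_eq_range_eigenvalues] at hx
    obtain ⟨i, rfl⟩ := hx
    exact hA.eigenvalues_pos i
  have hfin : (spectrum ℝ A).Finite := by
    rw [hA.isHermitian.spectrum_real_eq_range_eigenvalues]
    exact Set.finite_range _
  have hc : ∀ f : ℝ → ℝ, ContinuousOn f (spectrum ℝ A) := fun f => hfin.continuousOn f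
  have hsq : invSqrt A * invSqrt A * A = 1 := by
    unfold invSqrt
    conv_lhs => rw [← cfc_mul _ _ A (hc _) (hc _)]
    conv_lhs => enter [2]; rw [← cfc_id ℝ A hsa]
    rw [← cfc_mul _ _ A (hc _) (hc _), ← cfc_one ℝ A hsa]
    refine cfc_congr fun x hx => ?_
    have h := hpos x hx
    have h2 : Real.sqrt x ≠ 0 := (Real.sqrt_pos.2 h).ne'
    have h3 := Real.mul_self_sqrt h.le
    simp only [id, Pi.one_apply]
    field_simp
    nlinarith
  refine ⟨?_, (Matrix.inv_eq_left_inv hsq).symm⟩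
  have hherm : (invSqrt A).IsHermitian := by
    have := cfc_predicate (R := ℝ) (p := IsSelfAdjoint) (fun x : ℝ => (Real.sqrt x)⁻¹) A
    exact this
  rw [Matrix.PosSemidef.posDef_iff_isUnit]
  · have : invSqrt A * (invSqrt A * A) = 1 := by rw [← mul_assoc, hsq]
    exact IsUnit.of_mul_eq_one _ this
  · have hs : invSqrt A = cfc (fun x : ℝ => Real.sqrt ((Real.sqrt x)⁻¹)) A *
        cfc (fun x : ℝ => Real.sqrt ((Real.sqrt x)⁻¹)) A := by
      rw [← cfc_mul _ _ A (hc _) (hc _)]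
      refine cfc_congr fun x _ => ?_
      exact (Real.mul_self_sqrt (by positivity)).symm
    have h2 : (cfc (fun x : ℝ => Real.sqrt ((Real.sqrt x)⁻¹)) A)ᴴ =
        cfc (fun x : ℝ => Real.sqrt ((Real.sqrt x)⁻¹)) A :=
      cfc_predicate (R := ℝ) (p := IsSelfAdjoint) _ A
    rw [hs]
    nth_rewrite 1 [← h2]
    exact Matrix.posSemidef_conjTranspose_mul_self _

/-- For the path graph the architecture set consists of the tridiagonal symmetric matrices. -/
theorem mem_archSet_pathGraph {n : ℕ} (B : Matrix (Fin n) (Fin n) ℝ) :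
    B ∈ archSet (SimpleGraph.pathGraph n) ↔
      Bᵀ = B ∧ ∀ i j : Fin n, 1 < |(j : ℤ) - (i : ℤ)| → B i j = 0 := by
  unfold archSet
  refine and_congr_right fun _ => forall_congr' fun i => forall_congr' fun j => ?_
  rw [SimpleGraph.pathGraph_adj, lt_abs, Fin.ne_iff_vne]
  constructor
  · intro h hij; exact h (by omega) (by omega)
  · intro h h1 h2; exact h (by omega)
end RIS
/-- The tridiagonal architecture is tree-connected. -/
theorem RIS.isTree_pathGraph {n : ℕ} (hn : 0 < n) : (SimpleGraph.pathGraph n).IsTree := by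
  obtain ⟨m, rfl⟩ : ∃ m, n = m + 1 := ⟨n - 1, by omega⟩
  refine ⟨SimpleGraph.pathGraph_connected m, ?_⟩
  rw [SimpleGraph.isAcyclic_iff_forall_adj_isBridge]
  have key : ∀ u v : Fin (m + 1), u.val + 1 = v.val → (SimpleGraph.pathGraph (m+1)).IsBridge s(u, v) := by
    intro u v huv
    rw [SimpleGraph.isBridge_iff]
    rintro ⟨p⟩
    have : ∀ (a b : Fin (m+1)), ((SimpleGraph.pathGraph (m+1)).deleteEdges {s(u,v)}).Walk a b → a.val ≤ u.val → b.val ≤ u.val := by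
      intro a b q
      induction q with
      | nil => exact id
      | cons h q ih =>
        intro ha
        apply ih
        rw [SimpleGraph.deleteEdges_adj, SimpleGraph.pathGraph_adj] at h
        obtain ⟨h1, h2⟩ := h
        by_contra hc
        apply h2
        simp only [Set.mem_singleton_iff, Sym2.eq_iff, Fin.ext_iff]
        omega
    have := this u v p le_rfl
    omega
  intro u v h
  rcases SimpleGraph.pathGraph_adj.1 h with h | h
  · exact key u v h
  · rw [Sym2.eq_swap]; exact key v u h

end

/-! Four ideas carry the theorem.

Tightness of the SDR. A matrix `X ⪰ 0` with `tr (Q1 X) = 0` factors as `V Vᴴ` with `Vᴴ Q1 V`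
diagonal. For every sign vector `ε` the vector `V ε` is then a null vector of `Q1`, since squared
signs are 1 and the diagonal has sum zero. The average of `(V ε)ᴴ T (V ε)` over all signs is `tr (T
X)`, so a form that is nonpositive on null vectors of `Q1` is nonpositive at `X`
(`re_trace_mul_nonpos`). With `T = Q0 - Pu Q2` this bounds the SDP by the maximum `Pu` of the
relaxed problem, which exists by compactness.

Recovery. The Cayley transform turns `u = Θ a` into a real symmetric linear system `B p = q`, where
`p = R^(-1/2) (u + a)` and `‖u‖ = ‖a‖` says exactly that `pᴴ q` is real. The imaginary part of `conj
(p i) (B p) i` is the divergence at `i` of the flow `B i j Im (conj (p i) p j)`, so for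
non-degenerate `p` one needs a flow of prescribed divergence: it exists on a connected graph
(`exists_potential`) and is unique on an acyclic one (`flow_eq_zero`); the diagonal of `B` then fits
the real parts. On the complete graph the system is `B x = r`, `B y = s` over the reals, solved by
dual vectors.

Density. Stereographic projection of the sphere from `-a` makes `u + a` a real multiple of the
parameter, so non-degenerate vectors are dense on the sphere. Hence every feasible `u` is
approximated by some `Θ a`, and, `Θ` being an isometry, the supremum of the received power is `PT *
Pu`. Connectedness of the graph is all that is used here.

Low dimension. After a singular value decomposition, the entries of `u` beyond `NR` use up norm
without effect. Moving that norm into a leading entry with the right phase does not decrease the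
objective, and increases it if the singular value there is positive (`exists_l2_eq_improving`). -/

namespace RIS

/-! ### The Euclidean norm -/

section l2

variable {ι : Type*} [Fintype ι]

theorem l2_sq (v : ι → ℂ) : l2 v ^ 2 = ∑ i, ‖v i‖ ^ 2 :=
  EuclideanSpace.norm_sq_eq _

theorem l2_nonneg (v : ι → ℂ) : 0 ≤ l2 v := norm_nonneg _

theorem l2_eq_zero {v : ι → ℂ} : l2 v = 0 ↔ v = 0 := by
  unfold l2
  rw [norm_eq_zero, WithLp.toLp_eq_zero]

theorem l2_zero : l2 (0 : ι → ℂ) = 0 := l2_eq_zero.2 rfl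

theorem l2_smul (c : ℂ) (v : ι → ℂ) : l2 (c • v) = ‖c‖ * l2 v := by
  unfold l2
  rw [WithLp.toLp_smul, norm_smul]

theorem continuous_l2 : Continuous (l2 : (ι → ℂ) → ℝ) :=
  (PiLp.continuous_toLp 2 _).norm

theorem eventually_l2_sub_lt (u : ι → ℂ) {ε : ℝ} (hε : 0 < ε) :
    ∀ᶠ v in nhds u, l2 (u - v) < ε := by
  have h : Continuous fun v : ι → ℂ => l2 (u - v) := continuous_l2.comp (by fun_prop)
  have h0 : l2 (u - u) < ε := by rwa [sub_self, l2_zero]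
  exact h.continuousAt.eventually (gt_mem_nhds h0)

theorem star_dotProduct_self (v : ι → ℂ) : star v ⬝ᵥ v = ((l2 v ^ 2 : ℝ) : ℂ) := by
  rw [l2_sq, dotProduct, Complex.ofReal_sum]
  refine Finset.sum_congr rfl fun i _ => ?_
  rw [Pi.star_apply, Complex.star_def, Complex.conj_mul', Complex.ofReal_pow]

/-- The cross terms are a number minus its conjugate, hence imaginary. This identity gives both the
isometry property of `Θ` and the compatibility of the recovery system. -/
theorem re_star_add_dotProduct_sub (u a : ι → ℂ) :
    (star (u + a) ⬝ᵥ (u - a)).re = l2 u ^ 2 - l2 a ^ 2 := by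
  rw [l2_sq, l2_sq, ← Finset.sum_sub_distrib, dotProduct, Complex.re_sum]
  refine Finset.sum_congr rfl fun i _ => ?_
  rw [← Complex.normSq_eq_norm_sq, ← Complex.normSq_eq_norm_sq, Complex.normSq_apply,
    Complex.normSq_apply]
  simp
  ring

theorem norm_star_dotProduct_le (g v : ι → ℂ) : ‖star g ⬝ᵥ v‖ ≤ l2 g * l2 v := by
  have h := norm_inner_le_norm (𝕜 := ℂ) (WithLp.toLp 2 g : EuclideanSpace ℂ ι) (WithLp.toLp 2 v)
  rwa [EuclideanSpace.inner_eq_star_dotProduct, dotProduct_comm] at h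

theorem exists_l2_eq_one [Nonempty ι] : ∃ v : ι → ℂ, l2 v = 1 := by
  classical
  obtain ⟨i⟩ := ‹Nonempty ι›
  refine ⟨Pi.single i 1, ?_⟩
  unfold l2
  rw [PiLp.toLp_single, PiLp.norm_single, norm_one]

theorem exists_l2_eq [Nonempty ι] {r : ℝ} (hr : 0 ≤ r) : ∃ v : ι → ℂ, l2 v = r := by
  obtain ⟨v, hv⟩ := exists_l2_eq_one (ι := ι)
  exact ⟨(r : ℂ) • v, by rw [l2_smul, hv, Complex.norm_of_nonneg hr, mul_one]⟩

/-- Equality in Cauchy-Schwarz: the matched combiner is `v` normalized. -/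
theorem exists_l2_eq_one_norm_dotProduct_eq [Nonempty ι] (v : ι → ℂ) :
    ∃ g : ι → ℂ, l2 g = 1 ∧ ‖star g ⬝ᵥ v‖ = l2 v := by
  by_cases hv : v = 0
  · obtain ⟨g, hg⟩ := exists_l2_eq_one (ι := ι)
    exact ⟨g, hg, by rw [hv, dotProduct_zero, norm_zero, l2_zero]⟩
  have hv' : l2 v ≠ 0 := fun h => hv (l2_eq_zero.1 h)
  refine ⟨((l2 v)⁻¹ : ℂ) • v, ?_, ?_⟩
  · rw [l2_smul, norm_inv, Complex.norm_of_nonneg (l2_nonneg v), inv_mul_cancel₀ hv']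
  · rw [star_smul, smul_dotProduct, star_dotProduct_self, smul_eq_mul, norm_mul, norm_star, norm_inv,
      Complex.norm_of_nonneg (l2_nonneg v), Complex.norm_of_nonneg (sq_nonneg _), pow_two,
      inv_mul_cancel_left₀ hv']

theorem l2_mulVec_sq {m : Type*} [Fintype m] (A : Matrix m ι ℂ) (v : ι → ℂ) :
    ((l2 (A *ᵥ v) ^ 2 : ℝ) : ℂ) = star v ⬝ᵥ ((Aᴴ * A) *ᵥ v) := by
  rw [← star_dotProduct_self, Matrix.star_mulVec, ← Matrix.dotProduct_mulVec, Matrix.mulVec_mulVec]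

theorem l2_mulVec_of_isometry [DecidableEq ι] {m : Type*} [Fintype m] {U : Matrix m ι ℂ}
    (hU : Uᴴ * U = 1) (v : ι → ℂ) : l2 (U *ᵥ v) = l2 v := by
  have h := l2_mulVec_sq U v
  rw [hU, Matrix.one_mulVec, star_dotProduct_self] at h
  exact (sq_eq_sq₀ (l2_nonneg _) (l2_nonneg _)).1 (Complex.ofReal_injective h)

end l2

/-! ### The relaxed problem attains its maximum -/

section Relaxation

variable {NT NI NR k : ℕ}

theorem continuous_relaxObj (A : Matrix (Fin NR) (Fin NT) ℂ) (C : Matrix (Fin NR) (Fin k) ℂ) :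
    Continuous (relaxObj A C) := by
  unfold relaxObj
  exact (continuous_l2.comp (by fun_prop)).pow 2

theorem relaxSet_nonempty (hNT : 0 < NT) (hk : 0 < k) (E : Matrix (Fin NI) (Fin NT) ℂ) :
    (relaxSet k E).Nonempty := by
  have : Nonempty (Fin NT) := ⟨⟨0, hNT⟩⟩
  have : Nonempty (Fin k) := ⟨⟨0, hk⟩⟩
  obtain ⟨w, hw⟩ := exists_l2_eq_one (ι := Fin NT)
  obtain ⟨u, hu⟩ := exists_l2_eq (ι := Fin k) (l2_nonneg (E *ᵥ w))
  exact ⟨(w, u), hu, hw⟩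

theorem isCompact_l2_le {ι : Type*} [Fintype ι] (r : ℝ) : IsCompact {v : ι → ℂ | l2 v ≤ r} := by
  have h : {v : ι → ℂ | l2 v ≤ r} =
      WithLp.ofLp '' (Metric.closedBall (0 : EuclideanSpace ℂ ι) r) := by
    ext v
    simp only [Set.mem_ofPred_eq, Set.mem_image, Metric.mem_closedBall, dist_zero_right]
    exact ⟨fun hv => ⟨WithLp.toLp 2 v, hv, rfl⟩, by rintro ⟨x, hx, rfl⟩; exact hx⟩
  rw [h]
  exact (isCompact_closedBall _ _).image (PiLp.continuous_ofLp 2 _)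

/-- Since `w` lies in the unit ball, `‖u‖ = ‖E w‖` is bounded by the maximum of `‖E w‖` there. -/
theorem isCompact_relaxSet (k : ℕ) (E : Matrix (Fin NI) (Fin NT) ℂ) :
    IsCompact (relaxSet k E) := by
  have hE : Continuous fun w : Fin NT → ℂ => l2 (E *ᵥ w) := continuous_l2.comp (by fun_prop)
  obtain ⟨r, hr⟩ := ((isCompact_l2_le (ι := Fin NT) 1).image hE).bddAbove
  refine ((isCompact_l2_le (ι := Fin NT) 1).prod (isCompact_l2_le (ι := Fin k) r)).of_isClosed_subset
    ?_ ?_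
  · exact (isClosed_eq (continuous_l2.comp continuous_snd) (hE.comp continuous_fst)).inter
      (isClosed_eq (continuous_l2.comp continuous_fst) continuous_const)
  · rintro ⟨w, u⟩ ⟨h1, h2⟩
    refine ⟨h2.le, ?_⟩
    exact h1.le.trans (hr ⟨w, h2.le, rfl⟩)

theorem exists_isOptimal_relax (hNT : 0 < NT) (hk : 0 < k) (A : Matrix (Fin NR) (Fin NT) ℂ)
    (C : Matrix (Fin NR) (Fin k) ℂ) (E : Matrix (Fin NI) (Fin NT) ℂ) :
    ∃ p, IsOptimal (relaxSet k E) (relaxObj A C) p := by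
  obtain ⟨p, hp, h⟩ := (isCompact_relaxSet k E).exists_isMaxOn (relaxSet_nonempty hNT hk E)
    (continuous_relaxObj A C).continuousOn
  exact ⟨p, hp, fun y hy => h hy⟩

end Relaxation

/-! ### Positive semidefinite matrices and sign vectors -/

section Signs

variable {n : Type*} [Fintype n]

/-- For `i ≠ j`, flipping the sign of the `i`-th entry permutes the sign vectors and negates the
summand. -/
theorem sum_signs_mul [DecidableEq n] (i j : n) :
    ∑ ε : n → ℤˣ, (((ε i : ℤ) : ℂ) * ((ε j : ℤ) : ℂ)) =
      if i = j then (Fintype.card (n → ℤˣ) : ℂ) else 0 := by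
  split_ifs with h
  · subst h
    have : ∀ ε : n → ℤˣ, (((ε i : ℤ) : ℂ) * ((ε i : ℤ) : ℂ)) = 1 := by
      intro ε
      rw [← Int.cast_mul, ← Units.val_mul, Int.units_mul_self]; simp
    simp [this]
  · have hflip : ∑ ε : n → ℤˣ, (((ε i : ℤ) : ℂ) * ((ε j : ℤ) : ℂ)) =
        ∑ ε : n → ℤˣ, -(((ε i : ℤ) : ℂ) * ((ε j : ℤ) : ℂ)) := by
      refine Fintype.sum_equiv (Equiv.mulLeft (Function.update (1 : n → ℤˣ) i (-1))) _ _ fun ε => ?_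
      simp [Function.update_of_ne (Ne.symm h)]
    rw [Finset.sum_neg_distrib] at hflip
    exact self_eq_neg.1 hflip

/-- Off-diagonal terms cancel in the sum over signs, and each diagonal term is independent of the
signs. -/
theorem sum_signs_quadratic [DecidableEq n] (T : Matrix n n ℂ) :
    ∑ ε : n → ℤˣ, star (fun i => ((ε i : ℤ) : ℂ)) ⬝ᵥ (T *ᵥ fun i => ((ε i : ℤ) : ℂ)) =
      (Fintype.card (n → ℤˣ) : ℂ) * T.trace := by
  have h : ∀ ε : n → ℤˣ, star (fun i => ((ε i : ℤ) : ℂ)) ⬝ᵥ (T *ᵥ fun i => ((ε i : ℤ) : ℂ)) =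
      ∑ i, ∑ j, T i j * (((ε i : ℤ) : ℂ) * ((ε j : ℤ) : ℂ)) := by
    intro ε
    simp only [dotProduct, Matrix.mulVec, Finset.mul_sum, Pi.star_apply]
    refine Finset.sum_congr rfl fun i _ => Finset.sum_congr rfl fun j _ => ?_
    rw [star_intCast]; ring
  simp only [h]
  rw [Finset.sum_comm]
  simp only [Finset.sum_comm (s := (Finset.univ : Finset (n → ℤˣ)))]
  simp only [← Finset.mul_sum, sum_signs_mul, Matrix.trace, Matrix.diag]
  simp [Finset.mul_sum, mul_comm]

theorem PosSemidef.exists_eq_mul_conjTranspose {X : Matrix n n ℂ} (hX : X.PosSemidef) :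
    ∃ (m : ℕ) (V : Matrix n (Fin m) ℂ), X = V * Vᴴ := by
  obtain ⟨m, v, hv⟩ := Matrix.posSemidef_iff_eq_sum_vecMulVec.1 hX
  refine ⟨m, Matrix.of fun i k => v k i, ?_⟩
  rw [hv]
  ext i j
  simp [Matrix.sum_apply, Matrix.mul_apply, Matrix.vecMulVec_apply]

/-- A positive semidefinite matrix `X` has a factorization `V Vᴴ` that diagonalizes a given
Hermitian form. -/
theorem PosSemidef.exists_factor_diagonalizing {X Q : Matrix n n ℂ} (hX : X.PosSemidef)
    (hQ : Q.IsHermitian) : ∃ (m : ℕ) (V : Matrix n (Fin m) ℂ) (d : Fin m → ℂ),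
      X = V * Vᴴ ∧ Vᴴ * Q * V = Matrix.diagonal d := by
  obtain ⟨m, V, rfl⟩ := PosSemidef.exists_eq_mul_conjTranspose hX
  have hA : (Vᴴ * Q * V).IsHermitian := by
    unfold Matrix.IsHermitian
    rw [Matrix.conjTranspose_mul, Matrix.conjTranspose_mul, Matrix.conjTranspose_conjTranspose,
      hQ.eq, Matrix.mul_assoc]
  have hs := hA.spectral_theorem
  rw [Unitary.conjStarAlgAut_apply] at hs
  set W : Matrix (Fin m) (Fin m) ℂ := (hA.eigenvectorUnitary : Matrix (Fin m) (Fin m) ℂ) with hW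
  have h1 : W * star W = 1 := Unitary.mul_star_self_of_mem hA.eigenvectorUnitary.2
  have h2 : star W * W = 1 := Unitary.star_mul_self_of_mem hA.eigenvectorUnitary.2
  -- The unitary `W` of eigenvectors of `Vᴴ Q V` cancels in `(V W)(V W)ᴴ` and diagonalizes the form.
  refine ⟨m, V * W, RCLike.ofReal ∘ hA.eigenvalues, ?_, ?_⟩
  · rw [Matrix.conjTranspose_mul, Matrix.mul_assoc, ← Matrix.mul_assoc W, ← Matrix.star_eq_conjTranspose W,
      h1, Matrix.one_mul]
  · have : (V * W)ᴴ * Q * (V * W) = star W * (Vᴴ * Q * V) * W := by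
      rw [Matrix.conjTranspose_mul, Matrix.star_eq_conjTranspose]
      simp only [Matrix.mul_assoc]
    rw [this]
    generalize Matrix.diagonal (RCLike.ofReal ∘ hA.eigenvalues : Fin m → ℂ) = D at hs ⊢
    calc star W * (Vᴴ * Q * V) * W = (star W * W) * D * (star W * W) := by
          rw [hs]; simp only [Matrix.mul_assoc]
      _ = D := by rw [h2, Matrix.one_mul, Matrix.mul_one]

theorem star_dotProduct_mulVec_factor {m : Type*} [Fintype m] (V : Matrix n m ℂ)
    (T : Matrix n n ℂ) (x : m → ℂ) :
    star (V *ᵥ x) ⬝ᵥ (T *ᵥ (V *ᵥ x)) = star x ⬝ᵥ ((Vᴴ * T * V) *ᵥ x) := by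
  rw [Matrix.star_mulVec, ← Matrix.dotProduct_mulVec, Matrix.mulVec_mulVec, Matrix.mulVec_mulVec,
    Matrix.mul_assoc]

theorem trace_mul_factor {m : Type*} [Fintype m] (V : Matrix n m ℂ) (T : Matrix n n ℂ) :
    (T * (V * Vᴴ)).trace = (Vᴴ * T * V).trace := by
  rw [← Matrix.mul_assoc, Matrix.trace_mul_comm, Matrix.mul_assoc]

/-- If a form `T` is nonpositive on the null vectors of a Hermitian form `Q`, then `T` is
nonpositive on the positive semidefinite matrices orthogonal to `Q`. -/
theorem re_trace_mul_nonpos {X Q T : Matrix n n ℂ} (hX : X.PosSemidef) (hQ : Q.IsHermitian)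
    (h0 : (Q * X).trace = 0)
    (hT : ∀ x : n → ℂ, star x ⬝ᵥ (Q *ᵥ x) = 0 → (star x ⬝ᵥ (T *ᵥ x)).re ≤ 0) :
    ((T * X).trace).re ≤ 0 := by
  obtain ⟨m, V, d, rfl, hd⟩ := PosSemidef.exists_factor_diagonalizing hX hQ
  rw [trace_mul_factor] at h0 ⊢
  have hsum := sum_signs_quadratic (Vᴴ * T * V)
  have hle : (∑ ε : Fin m → ℤˣ, star (fun i => ((ε i : ℤ) : ℂ)) ⬝ᵥ
      ((Vᴴ * T * V) *ᵥ fun i => ((ε i : ℤ) : ℂ))).re ≤ 0 := by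
    rw [Complex.re_sum]
    refine Finset.sum_nonpos fun ε _ => ?_
    rw [← star_dotProduct_mulVec_factor]
    -- `V ε` is a null vector of `Q`: as `ε i ^ 2 = 1`, the diagonal form takes the value `∑ d i =
    -- tr (Q X) = 0` at `ε`.
    refine hT _ ?_
    rw [star_dotProduct_mulVec_factor, hd]
    rw [hd, Matrix.trace_diagonal] at h0
    rw [← h0]
    simp only [dotProduct, Matrix.mulVec_diagonal, Pi.star_apply]
    refine Finset.sum_congr rfl fun i _ => ?_
    rw [star_intCast, mul_left_comm, ← Int.cast_mul, ← Units.val_mul, Int.units_mul_self]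
    simp
  rw [hsum, ← Complex.ofReal_natCast, Complex.re_ofReal_mul] at hle
  have hc : (0 : ℝ) < (Fintype.card (Fin m → ℤˣ) : ℝ) := by exact_mod_cast Fintype.card_pos
  exact nonpos_of_mul_nonpos_right hle hc

/-- A positive semidefinite matrix of rank one is `x xᴴ` for some vector `x`. -/
theorem PosSemidef.exists_eq_vecMulVec_of_rank_eq_one {X : Matrix n n ℂ} (hX : X.PosSemidef)
    (h1 : X.rank = 1) : ∃ x : n → ℂ, X = Matrix.vecMulVec x (star x) := by
  classical
  obtain ⟨⟨v, hv⟩, hv0, hspan⟩ := finrank_eq_one_iff'.1 h1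
  have hv0' : v ≠ 0 := fun h => hv0 (Subtype.ext h)
  have hcol : ∀ j, ∃ c : ℂ, ∀ i, X i j = c * v i := by
    intro j
    obtain ⟨c, hc⟩ := hspan ⟨X.mulVecLin (Pi.single j 1), LinearMap.mem_range_self _ _⟩
    refine ⟨c, fun i => ?_⟩
    have := congrFun (congrArg Subtype.val hc) i
    simpa [Matrix.mulVecLin_apply] using this.symm
  choose c hc using hcol
  obtain ⟨k, hk⟩ := Function.ne_iff.1 hv0'
  simp only [Pi.zero_apply] at hk
  have hherm : ∀ i j, star (c i * v j) = c j * v i := by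
    intro i j
    rw [← hc, ← hc]
    exact hX.isHermitian.apply i j
  have hkk : 0 ≤ c k * v k := by
    rw [← hc]
    exact hX.diag_nonneg
  set s : ℝ := Real.sqrt (c k * v k).re with hs
  have hs2 : ((s : ℂ)) * s = c k * v k := by
    rw [← Complex.ofReal_mul, hs, Real.mul_self_sqrt (Complex.nonneg_iff.1 hkk).1]
    exact (Complex.eq_re_of_ofReal_le (r := 0) (by simpa using hkk)).symm
  have hvk : star (v k) ≠ 0 := star_ne_zero.2 hk
  refine ⟨((s : ℂ) / v k) • v, ?_⟩
  ext i j
  rw [hc, Matrix.vecMulVec_apply]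
  simp only [Pi.smul_apply, Pi.star_apply, smul_eq_mul, star_mul', star_div₀]
  have hsr : star (s : ℂ) = s := Complex.conj_ofReal s
  have h3 := hherm k j
  rw [star_mul'] at h3
  have h4 := hherm k k
  rw [star_mul'] at h4
  rw [hsr]
  field_simp
  have : c j * v k = star (c k) * star (v j) := h3.symm
  calc c j * v i * v k * star (v k) = star (c k) * star (v j) * v i * star (v k) := by
        rw [← this]; ring
    _ = (star (c k) * star (v k)) * star (v j) * v i := by ring
    _ = (s * s) * star (v j) * v i := by rw [h4, hs2]
    _ = _ := by ring

end Signs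

/-! ### The semidefinite relaxation -/

section SDR

variable {NT NI NR k : ℕ}

theorem star_dotProduct_sum {ι κ : Type*} [Fintype ι] [Fintype κ] (x : ι ⊕ κ → ℂ) (a : ι → ℂ)
    (b : κ → ℂ) : star x ⬝ᵥ Sum.elim a b = star (x ∘ Sum.inl) ⬝ᵥ a + star (x ∘ Sum.inr) ⬝ᵥ b := by
  simp [dotProduct, Fintype.sum_sum_type]

theorem Q0_quadratic (A : Matrix (Fin NR) (Fin NT) ℂ) (C : Matrix (Fin NR) (Fin k) ℂ)
    (x : Fin NT ⊕ Fin k → ℂ) :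
    star x ⬝ᵥ (Q0 A C *ᵥ x) = (relaxObj A C (x ∘ Sum.inl, x ∘ Sum.inr) : ℂ) := by
  unfold Q0 relaxObj
  rw [← star_dotProduct_self, Matrix.fromBlocks_mulVec, star_dotProduct_sum, star_add,
    Matrix.star_mulVec, Matrix.star_mulVec, add_dotProduct, ← Matrix.dotProduct_mulVec,
    ← Matrix.dotProduct_mulVec]
  simp only [Matrix.mulVec_add, Matrix.mulVec_mulVec]

theorem Q1_quadratic (E : Matrix (Fin NI) (Fin NT) ℂ) (x : Fin NT ⊕ Fin k → ℂ) :
    star x ⬝ᵥ (Q1 k E *ᵥ x) =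
      ((l2 (E *ᵥ (x ∘ Sum.inl)) ^ 2 - l2 (x ∘ Sum.inr) ^ 2 : ℝ) : ℂ) := by
  unfold Q1
  rw [Complex.ofReal_sub, ← star_dotProduct_self (x ∘ Sum.inr), l2_mulVec_sq,
    Matrix.fromBlocks_mulVec, star_dotProduct_sum]
  simp [Matrix.neg_mulVec, sub_eq_add_neg]

theorem Q2_quadratic (x : Fin NT ⊕ Fin k → ℂ) :
    star x ⬝ᵥ (Q2 NT k *ᵥ x) = ((l2 (x ∘ Sum.inl) ^ 2 : ℝ) : ℂ) := by
  unfold Q2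
  rw [← star_dotProduct_self, Matrix.fromBlocks_mulVec, star_dotProduct_sum]
  simp

theorem Q1_isHermitian (k : ℕ) (E : Matrix (Fin NI) (Fin NT) ℂ) : (Q1 k E).IsHermitian := by
  refine Matrix.IsHermitian.fromBlocks ?_ (by simp) ?_
  · exact Matrix.isHermitian_conjTranspose_mul_self E
  · exact Matrix.isHermitian_one.neg

theorem trace_mul_vecMulVec_star {ι : Type*} [Fintype ι] (Q : Matrix ι ι ℂ) (x : ι → ℂ) :
    (Q * Matrix.vecMulVec x (star x)).trace = star x ⬝ᵥ (Q *ᵥ x) := by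
  rw [Matrix.mul_vecMulVec, Matrix.trace_vecMulVec, dotProduct_comm]

/-- Makes the SDP a relaxation: its feasible points `x xᴴ` are the feasible pairs of the nonconvex
problem. -/
theorem vecMulVec_mem_sdpSet_iff {E : Matrix (Fin NI) (Fin NT) ℂ} {x : Fin NT ⊕ Fin k → ℂ} :
    Matrix.vecMulVec x (star x) ∈ sdpSet k E ↔
      (x ∘ Sum.inl, x ∘ Sum.inr) ∈ relaxSet k E := by
  unfold sdpSet relaxSet
  rw [Set.mem_ofPred_eq, Set.mem_ofPred_eq, trace_mul_vecMulVec_star, trace_mul_vecMulVec_star,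
    Q1_quadratic, Q2_quadratic, Complex.ofReal_eq_zero, Complex.ofReal_eq_one, sub_eq_zero,
    sq_eq_sq₀ (l2_nonneg _) (l2_nonneg _), pow_eq_one_iff_of_nonneg (l2_nonneg _) two_ne_zero]
  exact ⟨fun h => ⟨h.2.1.symm, h.2.2⟩,
      fun h => ⟨Matrix.posSemidef_vecMulVec_self_star x, h.1.symm, h.2⟩⟩

theorem sdpObj_vecMulVec (A : Matrix (Fin NR) (Fin NT) ℂ) (C : Matrix (Fin NR) (Fin k) ℂ)
    (x : Fin NT ⊕ Fin k → ℂ) :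
    sdpObj A C (Matrix.vecMulVec x (star x)) = relaxObj A C (x ∘ Sum.inl, x ∘ Sum.inr) := by
  unfold sdpObj
  rw [trace_mul_vecMulVec_star, Q0_quadratic, Complex.ofReal_re]

theorem relaxObj_smul (A : Matrix (Fin NR) (Fin NT) ℂ) (C : Matrix (Fin NR) (Fin k) ℂ) (c : ℂ)
    (w : Fin NT → ℂ) (u : Fin k → ℂ) :
    relaxObj A C (c • w, c • u) = ‖c‖ ^ 2 * relaxObj A C (w, u) := by
  unfold relaxObj
  rw [← mul_pow, ← l2_smul]
  simp only [Matrix.mulVec_smul, smul_add]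

/-- The bound on the relaxed problem, in homogeneous form. -/
theorem relaxObj_le_of_isOptimal {A : Matrix (Fin NR) (Fin NT) ℂ} {C : Matrix (Fin NR) (Fin k) ℂ}
    {E : Matrix (Fin NI) (Fin NT) ℂ} {p : (Fin NT → ℂ) × (Fin k → ℂ)}
    (hp : IsOptimal (relaxSet k E) (relaxObj A C) p) {w : Fin NT → ℂ} {u : Fin k → ℂ}
    (h : l2 u = l2 (E *ᵥ w)) : relaxObj A C (w, u) ≤ relaxObj A C p * l2 w ^ 2 := by
  by_cases hw : l2 w = 0
  -- If `w = 0` then the constraint forces `u = 0`; otherwise the pair is scaled by `1 / ‖w‖`.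
  · rw [hw]
    rw [l2_eq_zero] at hw
    subst hw
    rw [Matrix.mulVec_zero, l2_zero, l2_eq_zero] at h
    subst h
    simp [relaxObj, l2_zero]
  · have hmem : (((l2 w)⁻¹ : ℂ) • w, ((l2 w)⁻¹ : ℂ) • u) ∈ relaxSet k E := by
      refine ⟨?_, ?_⟩
      · simp only [Matrix.mulVec_smul, l2_smul, h]
      · simp only [l2_smul, norm_inv, Complex.norm_of_nonneg (l2_nonneg w)]
        exact inv_mul_cancel₀ hw
    have := hp.2 _ hmem
    rw [relaxObj_smul, norm_inv, Complex.norm_of_nonneg (l2_nonneg w), inv_pow,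
      inv_mul_le_iff₀ (by positivity)] at this
    linarith

/-- The homogeneous bound says that `Q0 - P Q2`, with `P` the relaxed optimum, is nonpositive on
null vectors of `Q1`. By `re_trace_mul_nonpos` it is so at `X`, where `tr (Q2 X) = 1`. -/
theorem sdpObj_le_of_isOptimal {A : Matrix (Fin NR) (Fin NT) ℂ} {C : Matrix (Fin NR) (Fin k) ℂ}
    {E : Matrix (Fin NI) (Fin NT) ℂ} {p : (Fin NT → ℂ) × (Fin k → ℂ)}
    (hp : IsOptimal (relaxSet k E) (relaxObj A C) p)
    {X : Matrix (Fin NT ⊕ Fin k) (Fin NT ⊕ Fin k) ℂ} (hX : X ∈ sdpSet k E) :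
    sdpObj A C X ≤ relaxObj A C p := by
  obtain ⟨hX0, hX1, hX2⟩ := hX
  have h := re_trace_mul_nonpos (T := Q0 A C - (relaxObj A C p : ℂ) • Q2 NT k) hX0
    (Q1_isHermitian k E) hX1 ?_
  · rw [Matrix.sub_mul, Matrix.trace_sub, Matrix.smul_mul, Matrix.trace_smul, hX2] at h
    simp only [smul_eq_mul, mul_one, Complex.sub_re, Complex.ofReal_re] at h
    exact sub_nonpos.1 h
  · intro x hx
    rw [Q1_quadratic, Complex.ofReal_eq_zero, sub_eq_zero,
      sq_eq_sq₀ (l2_nonneg _) (l2_nonneg _)] at hx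
    rw [Matrix.sub_mulVec, dotProduct_sub, Matrix.smul_mulVec, dotProduct_smul, Q0_quadratic,
      Q2_quadratic, smul_eq_mul, ← Complex.ofReal_mul, ← Complex.ofReal_sub, Complex.ofReal_re,
      sub_nonpos]
    exact relaxObj_le_of_isOptimal hp hx.symm

theorem isGreatest_relaxObj {A : Matrix (Fin NR) (Fin NT) ℂ} {C : Matrix (Fin NR) (Fin k) ℂ}
    {E : Matrix (Fin NI) (Fin NT) ℂ} {p : (Fin NT → ℂ) × (Fin k → ℂ)}
    (hp : IsOptimal (relaxSet k E) (relaxObj A C) p) :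
    IsGreatest (relaxObj A C '' relaxSet k E) (relaxObj A C p) :=
  ⟨⟨p, hp.1, rfl⟩, by rintro _ ⟨y, hy, rfl⟩; exact hp.2 y hy⟩

theorem isOptimal_vecMulVec {A : Matrix (Fin NR) (Fin NT) ℂ} {C : Matrix (Fin NR) (Fin k) ℂ}
    {E : Matrix (Fin NI) (Fin NT) ℂ} {w : Fin NT → ℂ} {u : Fin k → ℂ}
    (hp : IsOptimal (relaxSet k E) (relaxObj A C) (w, u)) :
    IsOptimal (sdpSet k E) (sdpObj A C)
      (Matrix.vecMulVec (Sum.elim w u) (star (Sum.elim w u))) := by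
  refine ⟨vecMulVec_mem_sdpSet_iff.2 (by simpa using hp.1), fun X hX => ?_⟩
  rw [sdpObj_vecMulVec]
  simpa using sdpObj_le_of_isOptimal hp hX

theorem isGreatest_sdpObj {A : Matrix (Fin NR) (Fin NT) ℂ} {C : Matrix (Fin NR) (Fin k) ℂ}
    {E : Matrix (Fin NI) (Fin NT) ℂ} {p : (Fin NT → ℂ) × (Fin k → ℂ)}
    (hp : IsOptimal (relaxSet k E) (relaxObj A C) p) :
    IsGreatest (sdpObj A C '' sdpSet k E) (relaxObj A C p) := by
  refine ⟨⟨_, (isOptimal_vecMulVec (w := p.1) (u := p.2) hp).1, ?_⟩, ?_⟩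
  · rw [sdpObj_vecMulVec]; simp
  · rintro _ ⟨X, hX, rfl⟩
    exact sdpObj_le_of_isOptimal hp hX

theorem rank_vecMulVec_star {ι : Type*} [Fintype ι] {x : ι → ℂ} (hx : x ≠ 0) :
    (Matrix.vecMulVec x (star x)).rank = 1 := by
  refine le_antisymm (Matrix.rank_vecMulVec_le _ _) ?_
  rw [Nat.one_le_iff_ne_zero]
  intro h
  classical
  rw [Matrix.rank, Submodule.finrank_eq_zero, LinearMap.range_eq_bot] at h
  replace h : Matrix.vecMulVec x (star x) = 0 := by
    ext i j
    simpa using congrFun (LinearMap.congr_fun h (Pi.single j 1)) i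
  obtain ⟨i, hi⟩ := Function.ne_iff.1 hx
  have := congrFun (congrFun h i) i
  simp only [Matrix.vecMulVec_apply, Pi.star_apply, Matrix.zero_apply, mul_eq_zero, star_eq_zero,
    or_self] at this
  exact hi this

/-- An optimal pair lifts to an optimal matrix of rank one, because it attains the bound of
`sdpObj_le_of_isOptimal`. Conversely an optimal `x xᴴ` does at least as well as this lift.
Positivity of `k` ensures that the relaxed problem is feasible. -/
theorem sdrTight (hNT : 0 < NT) (hk : 0 < k) (A : Matrix (Fin NR) (Fin NT) ℂ)
    (C : Matrix (Fin NR) (Fin k) ℂ) (E : Matrix (Fin NI) (Fin NT) ℂ) : SDRTight A C E := by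
  obtain ⟨⟨w, u⟩, hp⟩ := exists_isOptimal_relax hNT hk A C E
  refine ⟨⟨_, isOptimal_vecMulVec hp, rank_vecMulVec_star ?_⟩, ?_⟩
  · intro h
    have hw : w = 0 := by ext i; exact congrFun h (Sum.inl i)
    have := hp.1.2
    simp [hw, l2_zero] at this
  · intro X hX h1
    refine ⟨PosSemidef.exists_eq_vecMulVec_of_rank_eq_one hX.1.1 h1, ?_⟩
    rintro x rfl
    refine ⟨vecMulVec_mem_sdpSet_iff.1 hX.1, fun y hy => ?_⟩
    have h2 := hX.2 _ (isOptimal_vecMulVec hp).1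
    rw [sdpObj_vecMulVec, sdpObj_vecMulVec] at h2
    exact (hp.2 y hy).trans (by simpa using h2)

end SDR

/-! ### Reduction of the dimension by a singular value decomposition -/

section LowDim

variable {NT NI NR m n : ℕ}

theorem l2_add_single_sq {ι : Type*} [Fintype ι] [DecidableEq ι] (y : ι → ℂ) (i : ι) (z : ℂ) :
    l2 (y + Pi.single i z) ^ 2 = l2 y ^ 2 + 2 * (star (y i) * z).re + ‖z‖ ^ 2 := by
  have h : ∀ j, ‖(y + Pi.single i z : ι → ℂ) j‖ ^ 2 =
      ‖y j‖ ^ 2 + if j = i then 2 * (star (y i) * z).re + ‖z‖ ^ 2 else 0 := by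
    intro j
    split_ifs with hj
    · subst hj
      rw [Pi.add_apply, Pi.single_eq_same, ← Complex.normSq_eq_norm_sq, ← Complex.normSq_eq_norm_sq,
        ← Complex.normSq_eq_norm_sq, Complex.normSq_apply, Complex.normSq_apply,
        Complex.normSq_apply]
      simp
      ring
    · rw [Pi.add_apply, Pi.single_eq_of_ne hj]; simp
  rw [l2_sq, l2_sq]
  simp only [h, Finset.sum_add_distrib, Finset.sum_ite_eq', Finset.mem_univ, if_true]
  ring

theorem exists_phase (c : ℂ) : ∃ φ : ℂ, ‖φ‖ = 1 ∧ (star c * φ).re = ‖c‖ := by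
  by_cases hc : c = 0
  · exact ⟨1, by simp, by simp [hc]⟩
  · have h : ‖c‖ ≠ 0 := norm_ne_zero_iff.2 hc
    refine ⟨c / ‖c‖, by simp [h], ?_⟩
    rw [mul_div_assoc', Complex.star_def, Complex.conj_mul', pow_two, mul_div_assoc,
      div_self (by exact_mod_cast h), mul_one, Complex.ofReal_re]

/-- Enlarging the norm of a vector by a change of one entry such that the norm of `b + diag(σ) x`
does not decrease. -/
theorem exists_l2_eq_improving {ι : Type*} [Fintype ι] [DecidableEq ι] (i : ι) {σ : ι → ℝ}
    (hσ : 0 ≤ σ i) (b x : ι → ℂ) {r : ℝ} (hr : l2 x ≤ r) :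
    ∃ x' : ι → ℂ, l2 x' = r ∧
      l2 (b + fun j => (σ j : ℂ) * x j) ≤ l2 (b + fun j => (σ j : ℂ) * x' j) ∧
      (0 < σ i → l2 x < r →
        l2 (b + fun j => (σ j : ℂ) * x j) < l2 (b + fun j => (σ j : ℂ) * x' j)) := by
  set y : ι → ℂ := b + fun j => (σ j : ℂ) * x j with hy
  -- The phase of `y i`, so that the added term reinforces the current output at entry `i`.
  obtain ⟨φ, hφ, hφc⟩ := exists_phase (y i)
  set β : ℝ := (star (x i) * φ).re with hβ
  set τ : ℝ := r ^ 2 - l2 x ^ 2 with hτ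
  have hr0 : 0 ≤ r := (l2_nonneg x).trans hr
  have hτ0 : 0 ≤ τ := sub_nonneg.2 (pow_le_pow_left₀ (l2_nonneg x) hr 2)
  -- The nonnegative root of `s² + 2 β s = τ`: adding `s φ` to `x i` raises the squared norm by
  -- exactly `τ`, to `r²`.
  set s : ℝ := Real.sqrt (β ^ 2 + τ) - β with hs
  have hsq : Real.sqrt (β ^ 2 + τ) ^ 2 = β ^ 2 + τ := Real.sq_sqrt (by positivity)
  have hs0 : 0 ≤ s := sub_nonneg.2 (Real.le_sqrt_of_sq_le (by linarith))
  have hseq : s ^ 2 + 2 * s * β = τ := by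
    rw [hs]; linear_combination hsq
  have hshift : (b + fun j => (σ j : ℂ) * (x + Pi.single i ((s : ℂ) * φ) : ι → ℂ) j) =
      y + Pi.single i ((σ i : ℂ) * (s * φ)) := by
    ext j
    by_cases hj : j = i
    · subst hj; simp [hy]; ring
    · simp [hy, Pi.single_eq_of_ne hj]
  have hgain : l2 (y + Pi.single i ((σ i : ℂ) * (s * φ))) ^ 2 =
      l2 y ^ 2 + (2 * (σ i * s) * ‖y i‖ + (σ i * s) ^ 2) := by
    rw [l2_add_single_sq, norm_mul, norm_mul, hφ, Complex.norm_of_nonneg hσ,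
      Complex.norm_of_nonneg hs0, ← hφc]
    have : star (y i) * ((σ i : ℂ) * (s * φ)) = ((σ i * s : ℝ) : ℂ) * (star (y i) * φ) := by
      push_cast; ring
    rw [this, Complex.re_ofReal_mul]
    ring
  refine ⟨x + Pi.single i ((s : ℂ) * φ), ?_, ?_, ?_⟩
  · rw [← sq_eq_sq₀ (l2_nonneg _) hr0, l2_add_single_sq, norm_mul, hφ, Complex.norm_of_nonneg hs0]
    have : star (x i) * ((s : ℂ) * φ) = (s : ℂ) * (star (x i) * φ) := by ring
    rw [this, Complex.re_ofReal_mul, ← hβ]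
    linarith
  · rw [hshift, ← sq_le_sq₀ (l2_nonneg _) (l2_nonneg _), hgain]
    have : 0 ≤ 2 * (σ i * s) * ‖y i‖ + (σ i * s) ^ 2 := by positivity
    linarith
  · intro hσ0 hlt
    have hτ1 : 0 < τ := sub_pos.2 (pow_lt_pow_left₀ hlt (l2_nonneg x) two_ne_zero)
    have hs1 : 0 < s := by
      rcases hs0.lt_or_eq with h | h
      · exact h
      · rw [← h] at hseq; linarith
    rw [hshift, ← sq_lt_sq₀ (l2_nonneg _) (l2_nonneg _), hgain]
    have : 0 < 2 * (σ i * s) * ‖y i‖ + (σ i * s) ^ 2 := by positivity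
    linarith

theorem rectDiag_mulVec (h : m ≤ n) (σ : Fin m → ℝ) (v : Fin n → ℂ) :
    (rectDiag σ : Matrix (Fin m) (Fin n) ℂ) *ᵥ v = fun i => (σ i : ℂ) * v (Fin.castLE h i) := by
  ext i
  rw [Matrix.mulVec, dotProduct, Finset.sum_eq_single (Fin.castLE h i)]
  · simp [rectDiag]
  · intro j _ hj
    rw [rectDiag, if_neg, zero_mul]
    intro hij
    exact hj (Fin.ext hij.symm)
  · simp

theorem rectDiag_submatrix_mulVec (h : m ≤ n) (σ : Fin m → ℝ) (v : Fin m → ℂ) :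
    ((rectDiag σ : Matrix (Fin m) (Fin n) ℂ).submatrix id (Fin.castLE h)) *ᵥ v =
      fun i => (σ i : ℂ) * v i := by
  have : ((rectDiag σ : Matrix (Fin m) (Fin n) ℂ).submatrix id (Fin.castLE h)) =
      (rectDiag σ : Matrix (Fin m) (Fin m) ℂ) := rfl
  rw [this, rectDiag_mulVec le_rfl]
  rfl

theorem zeroPad_castLE (h : m ≤ n) (v : Fin m → ℂ) (i : Fin m) :
    zeroPad n v (Fin.castLE h i) = v i := by
  simp [zeroPad]

theorem l2_sq_eq_add_tail (h : m ≤ n) (v : Fin n → ℂ) :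
    l2 v ^ 2 = l2 (v ∘ Fin.castLE h) ^ 2 + ∑ j with m ≤ j.val, ‖v j‖ ^ 2 := by
  rw [l2_sq, l2_sq, ← Finset.sum_filter_add_sum_filter_not Finset.univ (fun j : Fin n => j.val < m)]
  simp only [not_lt]
  congr 1
  symm
  refine Finset.sum_bij (fun i _ => Fin.castLE h i) ?_ ?_ ?_ ?_
  · simp
  · intro a _ b _ hab; simpa using hab
  · intro j hj
    exact ⟨⟨j.val, (Finset.mem_filter.1 hj).2⟩, Finset.mem_univ _, rfl⟩
  · simp

theorem l2_comp_castLE_le (h : m ≤ n) (v : Fin n → ℂ) : l2 (v ∘ Fin.castLE h) ≤ l2 v := by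
  rw [← sq_le_sq₀ (l2_nonneg _) (l2_nonneg _), l2_sq_eq_add_tail h v]
  exact le_add_of_nonneg_right (Finset.sum_nonneg fun _ _ => sq_nonneg _)

theorem l2_comp_castLE_lt (h : m ≤ n) {v : Fin n → ℂ} {j : Fin n} (hj : m ≤ j.val)
    (hv : v j ≠ 0) : l2 (v ∘ Fin.castLE h) < l2 v := by
  rw [← sq_lt_sq₀ (l2_nonneg _) (l2_nonneg _), l2_sq_eq_add_tail h v]
  refine lt_add_of_pos_right _ (Finset.sum_pos' (fun _ _ => sq_nonneg _) ⟨j, ?_, ?_⟩)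
  · simpa using hj
  · exact pow_pos (norm_pos_iff.2 hv) 2

theorem l2_zeroPad (h : m ≤ n) (v : Fin m → ℂ) : l2 (zeroPad n v) = l2 v := by
  rw [← sq_eq_sq₀ (l2_nonneg _) (l2_nonneg _), l2_sq_eq_add_tail h]
  have h1 : zeroPad n v ∘ Fin.castLE h = v := funext fun i => zeroPad_castLE h v i
  rw [h1, Finset.sum_eq_zero, add_zero]
  intro j hj
  rw [zeroPad, dif_neg (not_lt.2 (Finset.mem_filter.1 hj).2)]
  simp

/-- The objective with the rectangular diagonal matrix, in terms of the leading entries. -/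
theorem relaxObj_rectDiag (h : NR ≤ NI) (A : Matrix (Fin NR) (Fin NT) ℂ) (σ : Fin NR → ℝ)
    (w : Fin NT → ℂ) (v : Fin NI → ℂ) :
    relaxObj A (rectDiag σ) (w, v) =
      l2 (A *ᵥ w + fun j => (σ j : ℂ) * (v ∘ Fin.castLE h) j) ^ 2 := by
  unfold relaxObj
  rw [rectDiag_mulVec h]
  rfl

theorem relaxObj_rectDiag_submatrix (h : NR ≤ NI) (A : Matrix (Fin NR) (Fin NT) ℂ)
    (σ : Fin NR → ℝ) (w : Fin NT → ℂ) (v : Fin NR → ℂ) :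
    relaxObj A ((rectDiag σ : Matrix (Fin NR) (Fin NI) ℂ).submatrix id (Fin.castLE h)) (w, v) =
      l2 (A *ᵥ w + fun j => (σ j : ℂ) * v j) ^ 2 := by
  unfold relaxObj
  rw [rectDiag_submatrix_mulVec h]

theorem relaxObj_zeroPad (h : NR ≤ NI) (A : Matrix (Fin NR) (Fin NT) ℂ)
    (σ : Fin NR → ℝ) (w : Fin NT → ℂ) (v : Fin NR → ℂ) :
    relaxObj A (rectDiag σ) (w, zeroPad NI v) =
      relaxObj A ((rectDiag σ : Matrix (Fin NR) (Fin NI) ℂ).submatrix id (Fin.castLE h)) (w, v) := by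
  rw [relaxObj_rectDiag h, relaxObj_rectDiag_submatrix h]
  simp only [Function.comp_apply, zeroPad_castLE]

theorem zeroPad_mem_relaxSet_iff (h : NR ≤ NI) {E : Matrix (Fin NI) (Fin NT) ℂ} {w : Fin NT → ℂ}
    {v : Fin NR → ℂ} : (w, zeroPad NI v) ∈ relaxSet NI E ↔ (w, v) ∈ relaxSet NR E := by
  unfold relaxSet
  rw [Set.mem_ofPred_eq, Set.mem_ofPred_eq, l2_zeroPad h]

/-- The problem with the square diagonal matrix has the same optimal solutions, up to padding. -/
theorem isOptimal_zeroPad_iff (h : NR ≤ NI) (hNR : 0 < NR) {A : Matrix (Fin NR) (Fin NT) ℂ}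
    {E : Matrix (Fin NI) (Fin NT) ℂ} {σ : Fin NR → ℝ} (hσ : ∀ i, 0 ≤ σ i) {w : Fin NT → ℂ}
    {v : Fin NR → ℂ} :
    IsOptimal (relaxSet NR E)
        (relaxObj A ((rectDiag σ : Matrix (Fin NR) (Fin NI) ℂ).submatrix id (Fin.castLE h))) (w, v) ↔
      IsOptimal (relaxSet NI E) (relaxObj A (rectDiag σ)) (w, zeroPad NI v) := by
  constructor
  · intro hp
    refine ⟨(zeroPad_mem_relaxSet_iff h).2 hp.1, ?_⟩
    rintro ⟨w', v'⟩ ⟨h1, h2⟩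
    -- The norm lost by cutting off the tail of `v'` is restored in entry 0; any entry would do,
    -- since only `0 ≤ σ i` matters.
    obtain ⟨x, hx, hle, -⟩ := exists_l2_eq_improving (⟨0, hNR⟩ : Fin NR) (hσ _) (A *ᵥ w')
      (v' ∘ Fin.castLE h) (l2_comp_castLE_le h v')
    rw [relaxObj_zeroPad h]
    refine le_trans ?_ (hp.2 (w', x) ⟨hx.trans h1, h2⟩)
    rw [relaxObj_rectDiag h, relaxObj_rectDiag_submatrix h]
    exact pow_le_pow_left₀ (l2_nonneg _) hle 2
  · intro hp
    refine ⟨(zeroPad_mem_relaxSet_iff h).1 hp.1, ?_⟩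
    rintro ⟨w', v'⟩ hmem
    rw [← relaxObj_zeroPad h, ← relaxObj_zeroPad h]
    exact hp.2 _ ((zeroPad_mem_relaxSet_iff h).2 hmem)

/-- A nonzero tail entry uses up norm without affecting the objective; spending that norm at `i₀`,
where the singular value is positive, would be strictly better. -/
theorem tail_eq_zero_of_isOptimal (h : NR ≤ NI) {i₀ : Fin NR} {A : Matrix (Fin NR) (Fin NT) ℂ}
    {E : Matrix (Fin NI) (Fin NT) ℂ} {σ : Fin NR → ℝ} (hσ : 0 < σ i₀) {w : Fin NT → ℂ}
    {v : Fin NI → ℂ} (hp : IsOptimal (relaxSet NI E) (relaxObj A (rectDiag σ)) (w, v))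
    {j : Fin NI} (hj : NR ≤ j.val) : v j = 0 := by
  by_contra hv
  obtain ⟨x, hx, -, hlt⟩ := exists_l2_eq_improving i₀ hσ.le (A *ᵥ w)
    (v ∘ Fin.castLE h) (l2_comp_castLE_le h v)
  have h1 := hp.2 (w, zeroPad NI x) ((zeroPad_mem_relaxSet_iff h).2 ⟨hx.trans hp.1.1, hp.1.2⟩)
  rw [relaxObj_zeroPad h, relaxObj_rectDiag h, relaxObj_rectDiag_submatrix h] at h1
  have h2 := pow_lt_pow_left₀ (hlt hσ (l2_comp_castLE_lt h hj hv)) (l2_nonneg _) two_ne_zero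
  exact absurd h1 (not_le.2 h2)

theorem IsSVD.eq_mul {H : Matrix (Fin m) (Fin n) ℂ} {U : Matrix (Fin m) (Fin m) ℂ}
    {σ : Fin m → ℝ} {V : Matrix (Fin n) (Fin n) ℂ} (hs : IsSVD H U σ V) :
    H = U * ((rectDiag σ : Matrix (Fin m) (Fin n) ℂ) * Vᴴ) := by
  rw [← Matrix.mul_assoc]
  exact hs.2.2.2.2

theorem IsSVD.pos_of_ne_zero {H : Matrix (Fin m) (Fin n) ℂ} {U : Matrix (Fin m) (Fin m) ℂ}
    {σ : Fin m → ℝ} {V : Matrix (Fin n) (Fin n) ℂ} (hs : IsSVD H U σ V) (hH : H ≠ 0) :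
    ∃ i, 0 < σ i := by
  by_contra! hneg
  refine hH ?_
  have h0 := hs.2.2.1
  have : (rectDiag σ : Matrix (Fin m) (Fin n) ℂ) = 0 := by
    ext i j
    have : σ i = 0 := le_antisymm (hneg i) (h0 i)
    simp [rectDiag, this]
  rw [hs.eq_mul, this, Matrix.zero_mul, Matrix.mul_zero]

theorem IsSVD.relaxObj_eq {A : Matrix (Fin NR) (Fin NT) ℂ} {H : Matrix (Fin NR) (Fin NI) ℂ}
    {U : Matrix (Fin NR) (Fin NR) ℂ} {σ : Fin NR → ℝ} {V : Matrix (Fin NI) (Fin NI) ℂ}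
    (hs : IsSVD H U σ V) (w : Fin NT → ℂ) (u : Fin NI → ℂ) :
    relaxObj A H (w, u) = relaxObj (Uᴴ * A) (rectDiag σ) (w, Vᴴ *ᵥ u) := by
  have hU := hs.1
  unfold relaxObj
  have h1 : Uᴴ * U = 1 := (Matrix.mem_unitaryGroup_iff' (A := U)).1 hU
  have h2 : Uᴴᴴ * Uᴴ = 1 := by
    rw [Matrix.conjTranspose_conjTranspose]; exact Matrix.mem_unitaryGroup_iff.1 hU
  rw [← l2_mulVec_of_isometry h2]
  rw [Matrix.mulVec_add, Matrix.mulVec_mulVec, Matrix.mulVec_mulVec, Matrix.mulVec_mulVec,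
    hs.eq_mul, ← Matrix.mul_assoc Uᴴ U, h1, Matrix.one_mul]

theorem IsSVD.isOptimal_iff {A : Matrix (Fin NR) (Fin NT) ℂ} {E : Matrix (Fin NI) (Fin NT) ℂ}
    {H : Matrix (Fin NR) (Fin NI) ℂ} {U : Matrix (Fin NR) (Fin NR) ℂ} {σ : Fin NR → ℝ}
    {V : Matrix (Fin NI) (Fin NI) ℂ} (hs : IsSVD H U σ V) (w : Fin NT → ℂ) (u : Fin NI → ℂ) :
    IsOptimal (relaxSet NI E) (relaxObj A H) (w, u) ↔
      IsOptimal (relaxSet NI E) (relaxObj (Uᴴ * A) (rectDiag σ)) (w, Vᴴ *ᵥ u) := by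
  have hV1 : Vᴴ * V = 1 := (Matrix.mem_unitaryGroup_iff' (A := V)).1 hs.2.1
  have hV2 : V * Vᴴ = 1 := (Matrix.mem_unitaryGroup_iff (A := V)).1 hs.2.1
  have hmem : ∀ w u, (w, Vᴴ *ᵥ u) ∈ relaxSet NI E ↔ (w, u) ∈ relaxSet NI E := by
    intro w u
    unfold relaxSet
    rw [Set.mem_ofPred_eq, Set.mem_ofPred_eq,
      l2_mulVec_of_isometry (by rw [Matrix.conjTranspose_conjTranspose, hV2])]
  constructor
  · intro hp
    refine ⟨(hmem w u).2 hp.1, ?_⟩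
    rintro ⟨w', v'⟩ hv'
    have hv : Vᴴ *ᵥ (V *ᵥ v') = v' := by rw [Matrix.mulVec_mulVec, hV1, Matrix.one_mulVec]
    rw [← hv, ← hs.relaxObj_eq, ← hs.relaxObj_eq]
    refine hp.2 _ ((hmem _ _).1 ?_)
    rwa [hv]
  · intro hp
    refine ⟨(hmem w u).1 hp.1, ?_⟩
    rintro ⟨w', u'⟩ hu'
    rw [hs.relaxObj_eq, hs.relaxObj_eq]
    exact hp.2 _ ((hmem _ _).2 hu')

theorem IsSVD.isOptimal_zeroPad_iff (h : NR ≤ NI) (hNR : 0 < NR) {A : Matrix (Fin NR) (Fin NT) ℂ}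
    {E : Matrix (Fin NI) (Fin NT) ℂ} {H : Matrix (Fin NR) (Fin NI) ℂ}
    {U : Matrix (Fin NR) (Fin NR) ℂ} {σ : Fin NR → ℝ} {V : Matrix (Fin NI) (Fin NI) ℂ}
    (hs : IsSVD H U σ V) (w : Fin NT → ℂ) (v : Fin NR → ℂ) :
    IsOptimal (relaxSet NR E) (relaxObj (Uᴴ * A)
        ((rectDiag σ : Matrix (Fin NR) (Fin NI) ℂ).submatrix id (Fin.castLE h))) (w, v) ↔
      IsOptimal (relaxSet NI E) (relaxObj A H) (w, V *ᵥ zeroPad NI v) := by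
  have hV1 : Vᴴ * V = 1 := (Matrix.mem_unitaryGroup_iff' (A := V)).1 hs.2.1
  rw [RIS.isOptimal_zeroPad_iff h hNR hs.2.2.1, hs.isOptimal_iff, Matrix.mulVec_mulVec, hV1,
    Matrix.one_mulVec]

end LowDim

/-! ### Flows on graphs -/

section Flow

variable {V : Type*} [Fintype V]

/-- On a connected graph every divergence of total sum zero belongs to a potential. -/
theorem exists_potential [DecidableEq V] {G : SimpleGraph V} [DecidableRel G.Adj]
    (hG : G.Connected) {d : V → ℝ} (hd : ∑ i, d i = 0) :
    ∃ φ : V → ℝ, ∀ i, ∑ j, (if G.Adj i j then φ i - φ j else 0) = d i := by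
  set L : Matrix V V ℝ := G.lapMatrix ℝ with hL
  -- The Laplacian `L` is singular, but `L + J` is invertible: the kernel of `L` consists of the
  -- constants, on which `J` is injective, and `L x` always has sum zero. For a right-hand side of
  -- sum zero the solution also has sum zero, so `J` drops out.
  set J : Matrix V V ℝ := Matrix.of fun _ _ => 1 with hJ
  have hJx : ∀ (x : V → ℝ) i, (J *ᵥ x) i = ∑ j, x j := by
    intro x i; simp [hJ, Matrix.mulVec, dotProduct]
  have hLsum : ∀ x : V → ℝ, ∑ i, (L *ᵥ x) i = 0 := by
    intro x
    have h1 : ∑ i, (L *ᵥ x) i = (fun _ : V => (1 : ℝ)) ⬝ᵥ (L *ᵥ x) := by simp [dotProduct]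
    rw [h1, Matrix.dotProduct_mulVec, ← Matrix.mulVec_transpose, (G.isSymm_lapMatrix ℝ).eq,
      G.lapMatrix_mulVec_const_eq_zero, zero_dotProduct]
  have hcard : (Fintype.card V : ℝ) ≠ 0 := by
    have := hG.nonempty
    exact_mod_cast Fintype.card_ne_zero
  have hsum : ∀ x : V → ℝ, ∑ i, ((L + J) *ᵥ x) i = Fintype.card V * ∑ j, x j := by
    intro x
    simp only [Matrix.add_mulVec, Pi.add_apply, Finset.sum_add_distrib, hLsum, hJx, zero_add,
      Finset.sum_const, Finset.card_univ, nsmul_eq_mul]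
  have hzero : ∀ x : V → ℝ, ∑ i, ((L + J) *ᵥ x) i = 0 → (L + J) *ᵥ x = L *ᵥ x ∧ ∑ j, x j = 0 := by
    intro x hx
    rw [hsum, mul_eq_zero, or_iff_right hcard] at hx
    refine ⟨?_, hx⟩
    ext i
    rw [Matrix.add_mulVec, Pi.add_apply, hJx, hx, add_zero]
  have hinj : Function.Injective (L + J).mulVec := by
    rw [← Matrix.coe_mulVecLin, injective_iff_map_eq_zero]
    intro x hx
    rw [Matrix.mulVecLin_apply] at hx
    obtain ⟨h1, h2⟩ := hzero x (by simp [hx])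
    rw [hx] at h1
    have h3 := (G.lapMatrix_mulVec_eq_zero_iff_forall_reachable).1 h1.symm
    ext i
    have h4 : ∑ j, x j = Fintype.card V * x i := by
      rw [Finset.sum_congr rfl fun j _ => h3 j i (hG.preconnected j i)]
      simp
    rw [h2] at h4
    exact (mul_eq_zero.1 h4.symm).resolve_left hcard
  obtain ⟨φ, hφ⟩ := Matrix.mulVec_surjective_iff_isUnit.2 (Matrix.mulVec_injective_iff_isUnit.1 hinj) d
  refine ⟨φ, fun i => ?_⟩
  have h1 := (hzero φ (by rw [hφ, hd])).1
  rw [hφ] at h1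
  rw [h1, hL, G.lapMatrix_mulVec_apply, ← Finset.sum_filter, Finset.sum_sub_distrib,
    Finset.sum_const, nsmul_eq_mul, ← G.card_neighborFinset_eq_degree, G.neighborFinset_eq_filter]

/-- A flow without divergence on an acyclic graph vanishes. -/
theorem flow_eq_zero {G : SimpleGraph V} (hG : G.IsAcyclic) {c : V → V → ℝ}
    (hanti : ∀ i j, c j i = -c i j) (hsupp : ∀ i j, ¬ G.Adj i j → c i j = 0)
    (hdiv : ∀ i, ∑ j, c i j = 0) (u v : V) : c u v = 0 := by
  classical
  by_cases huv : G.Adj u v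
  swap
  · exact hsupp u v huv
  have hbr := SimpleGraph.isAcyclic_iff_forall_adj_isBridge.1 hG huv
  rw [SimpleGraph.isBridge_iff] at hbr
  -- The side of the bridge that contains `u`. The divergences over `S` add up to the net flow out
  -- of `S`, and the bridge is the only edge that leaves it.
  set S : V → Prop := fun x => (G.deleteEdges {s(u, v)}).Reachable u x with hS
  have hSv : ¬ S v := hbr
  have hSu : S u := SimpleGraph.Reachable.refl _
  have hcross : ∀ i j, S i → ¬ S j → c i j ≠ 0 → i = u ∧ j = v := by
    intro i j hi hj hc
    have hadj : G.Adj i j := by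
      by_contra h; exact hc (hsupp i j h)
    by_contra hne
    refine hj (hi.trans (SimpleGraph.Adj.reachable ?_))
    rw [SimpleGraph.deleteEdges_adj]
    refine ⟨hadj, ?_⟩
    rw [Set.mem_singleton_iff, Sym2.eq_iff]
    rintro (h | ⟨rfl, rfl⟩)
    · exact hne h
    · exact hSv hi
  have h1 : ∑ i, ∑ j, (if S i then c i j else 0) = 0 := by
    refine Finset.sum_eq_zero fun i _ => ?_
    split_ifs
    · exact hdiv i
    · simp
  -- Flow inside `S` cancels by antisymmetry.
  have h2 : ∑ i, ∑ j, (if S i ∧ S j then c i j else 0) = 0 := by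
    have : ∑ i, ∑ j, (if S i ∧ S j then c i j else 0) =
        -∑ i, ∑ j, (if S i ∧ S j then c i j else 0) := by
      conv_lhs => rw [Finset.sum_comm]
      simp only [← Finset.sum_neg_distrib]
      refine Finset.sum_congr rfl fun i _ => Finset.sum_congr rfl fun j _ => ?_
      rw [hanti i j]
      by_cases hi : S i <;> by_cases hj : S j <;> simp [hi, hj]
    linarith
  have h3 : ∑ i, ∑ j, (if S i ∧ ¬ S j then c i j else 0) = c u v := by
    rw [Finset.sum_eq_single u, Finset.sum_eq_single v, if_pos ⟨hSu, hSv⟩]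
    · intro j _ hj
      split_ifs with h
      · by_contra hc; exact hj (hcross u j h.1 h.2 hc).2
      · rfl
    · simp
    · intro i _ hi
      refine Finset.sum_eq_zero fun j _ => ?_
      split_ifs with h
      · by_contra hc; exact hi (hcross i j h.1 h.2 hc).1
      · rfl
    · simp
  have h4 : ∑ i, ∑ j, (if S i then c i j else 0) = ∑ i, ∑ j, (if S i ∧ S j then c i j else 0) +
      ∑ i, ∑ j, (if S i ∧ ¬ S j then c i j else 0) := by
    simp only [← Finset.sum_add_distrib]
    refine Finset.sum_congr rfl fun i _ => Finset.sum_congr rfl fun j _ => ?_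
    by_cases hi : S i <;> by_cases hj : S j <;> simp [hi, hj]
  linarith

end Flow

/-! ### Symmetric real matrices with prescribed values -/

section SymmetricSystem

variable {n : ℕ}

theorem toC_mulVec_apply (B : Matrix (Fin n) (Fin n) ℝ) (p : Fin n → ℂ) (i : Fin n) :
    (toC B *ᵥ p) i = ∑ j, (B i j : ℂ) * p j := rfl

/-- Turns the linear system into a flow problem: for symmetric `B` the summands are antisymmetric in
`i` and `j`, and the diagonal of `B` does not contribute. -/
theorem star_mul_toC_mulVec_im (B : Matrix (Fin n) (Fin n) ℝ) (p : Fin n → ℂ) (i : Fin n) :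
    (star (p i) * (toC B *ᵥ p) i).im = ∑ j, B i j * (star (p i) * p j).im := by
  rw [toC_mulVec_apply, Finset.mul_sum, Complex.im_sum]
  refine Finset.sum_congr rfl fun j _ => ?_
  rw [mul_left_comm, Complex.im_ofReal_mul]

theorem star_mul_im_anti (a b : ℂ) : (star b * a).im = -(star a * b).im := by
  simp
  ring

theorem star_mul_self_im (a : ℂ) : (star a * a).im = 0 := by
  simp; ring

theorem toC_add_mulVec (A B : Matrix (Fin n) (Fin n) ℝ) (p : Fin n → ℂ) :
    toC (A + B) *ᵥ p = toC A *ᵥ p + toC B *ᵥ p := by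
  rw [← Matrix.add_mulVec]
  congr 1
  ext i j
  simp [toC]

theorem toC_sub_mulVec (A B : Matrix (Fin n) (Fin n) ℝ) (p : Fin n → ℂ) :
    toC (A - B) *ᵥ p = toC A *ᵥ p - toC B *ᵥ p := by
  rw [← Matrix.sub_mulVec]
  congr 1
  ext i j
  simp [toC]

theorem toC_diagonal_mulVec (t : Fin n → ℝ) (p : Fin n → ℂ) :
    toC (Matrix.diagonal t) *ᵥ p = fun i => (t i : ℂ) * p i := by
  have : toC (Matrix.diagonal t) = Matrix.diagonal fun i => (t i : ℂ) :=
    Matrix.diagonal_map Complex.ofReal_zero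
  rw [this]
  ext i
  rw [Matrix.mulVec_diagonal]

/-- No entry of `p` vanishes, and entries at adjacent vertices are linearly independent over the
reals. -/
def VecNonDegenerate (G : SimpleGraph (Fin n)) (p : Fin n → ℂ) : Prop :=
  (∀ i, p i ≠ 0) ∧ ∀ i j, G.Adj i j → (star (p i) * p j).im ≠ 0

/-- After multiplication of the `i`-th equation by `conj (p i)`, the imaginary parts prescribe the
divergence of a flow, with total zero by `hpq`. A potential flow fixes the off-diagonal entries. The
diagonal then adjusts the real parts. -/
theorem exists_mem_archSet_of_nonDegenerate {G : SimpleGraph (Fin n)} (hG : G.Connected)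
    {p q : Fin n → ℂ} (hp : VecNonDegenerate G p) (hpq : (star p ⬝ᵥ q).im = 0) :
    ∃ B ∈ archSet G, toC B *ᵥ p = q := by
  classical
  obtain ⟨φ, hφ⟩ := exists_potential hG (d := fun i => (star (p i) * q i).im) (by
    rw [← Complex.im_sum]; exact hpq)
  -- A quotient of two antisymmetric quantities, hence symmetric.
  set W : Matrix (Fin n) (Fin n) ℝ := Matrix.of fun i j =>
    if G.Adj i j then (φ i - φ j) / (star (p i) * p j).im else 0 with hW
  have hWapp : ∀ i j, W i j = if G.Adj i j then (φ i - φ j) / (star (p i) * p j).im else 0 :=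
    fun _ _ => rfl
  set t : Fin n → ℝ := fun i =>
    ((star (p i) * q i).re - (star (p i) * (toC W *ᵥ p) i).re) / ‖p i‖ ^ 2 with ht
  refine ⟨W + Matrix.diagonal t, ⟨?_, ?_⟩, ?_⟩
  · rw [Matrix.transpose_add, Matrix.diagonal_transpose]
    congr 1
    ext i j
    rw [Matrix.transpose_apply, hWapp, hWapp, G.adj_comm j i, star_mul_im_anti (p i) (p j)]
    split_ifs
    · rw [div_neg, ← neg_div, neg_sub]
    · rfl
  · intro i j hij hadj
    rw [Matrix.add_apply, Matrix.diagonal_apply_ne _ hij, hWapp, if_neg hadj, add_zero]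
  · ext i
    have hpi := hp.1 i
    have hn : ‖p i‖ ^ 2 ≠ 0 := by positivity
    refine mul_left_cancel₀ (star_ne_zero.2 hpi) ?_
    rw [toC_add_mulVec, toC_diagonal_mulVec, Pi.add_apply, mul_add]
    have hself : star (p i) * ((t i : ℂ) * p i) = ((t i * ‖p i‖ ^ 2 : ℝ) : ℂ) := by
      rw [mul_left_comm, Complex.star_def, Complex.conj_mul']; push_cast; rfl
    rw [hself]
    apply Complex.ext
    · rw [Complex.add_re, Complex.ofReal_re, ht]
      field_simp
      ring
    · rw [Complex.add_im, Complex.ofReal_im, add_zero, star_mul_toC_mulVec_im, ← hφ i]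
      refine Finset.sum_congr rfl fun j _ => ?_
      rw [hWapp]
      split_ifs with h
      · exact div_mul_cancel₀ _ (hp.2 i j h)
      · exact zero_mul _

/-- A matrix in the kernel gives a flow without divergence on a forest, so its off-diagonal entries
vanish; then `B i i * p i = 0` for each `i`. -/
theorem eq_zero_of_toC_mulVec_eq_zero {G : SimpleGraph (Fin n)} (hG : G.IsAcyclic)
    {p : Fin n → ℂ} (hp : VecNonDegenerate G p) {B : Matrix (Fin n) (Fin n) ℝ}
    (hB : B ∈ archSet G) (h0 : toC B *ᵥ p = 0) : B = 0 := by
  have hsymm : ∀ i j, B j i = B i j := fun i j => congrFun (congrFun hB.1 i) j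
  have hoff : ∀ i j, B i j * (star (p i) * p j).im = 0 := by
    refine flow_eq_zero hG ?_ ?_ ?_
    · intro i j
      rw [hsymm i j, star_mul_im_anti (p i) (p j), mul_neg]
    · intro i j hij
      by_cases h : i = j
      · subst h; rw [star_mul_self_im, mul_zero]
      · rw [hB.2 i j h hij, zero_mul]
    · intro i
      rw [← star_mul_toC_mulVec_im, h0]; simp
  have hne : ∀ i j, i ≠ j → B i j = 0 := by
    intro i j hij
    by_cases h : G.Adj i j
    · exact (mul_eq_zero.1 (hoff i j)).resolve_right (hp.2 i j h)
    · exact hB.2 i j hij h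
  ext i j
  by_cases hij : i = j
  · subst hij
    have h1 := congrFun h0 i
    rw [toC_mulVec_apply, Finset.sum_eq_single i (fun j _ hj => by rw [hne i j hj.symm]; simp)
      (by simp)] at h1
    exact_mod_cast (mul_eq_zero.1 h1).resolve_right (hp.1 i)
  · exact hne i j hij

theorem exists_ne_zero_of_not_nonDegenerate {G : SimpleGraph (Fin n)} {p : Fin n → ℂ}
    (hp : ¬ VecNonDegenerate G p) : ∃ B ∈ archSet G, B ≠ 0 ∧ toC B *ᵥ p = 0 := by
  have hzero : ∀ i, p i = 0 → ∃ B ∈ archSet G, B ≠ 0 ∧ toC B *ᵥ p = 0 := by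
    intro i hi
    refine ⟨Matrix.diagonal (Pi.single i 1), ⟨Matrix.diagonal_transpose _, ?_⟩, ?_, ?_⟩
    · intro j k hjk _
      exact Matrix.diagonal_apply_ne _ hjk
    · intro h
      have := congrFun (congrFun h i) i
      simp at this
    · rw [toC_diagonal_mulVec]
      ext j
      by_cases hj : j = i
      · subst hj; simp [hi]
      · simp [Pi.single_eq_of_ne hj]
  by_cases h1 : ∀ i, p i ≠ 0
  · obtain ⟨i, j, hadj, him⟩ : ∃ i j, G.Adj i j ∧ (star (p i) * p j).im = 0 := by
      by_contra! h
      exact hp ⟨h1, h⟩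
    have hij : i ≠ j := hadj.ne
    set ρ : ℝ := (star (p i) * p j).re / ‖p i‖ ^ 2 with hρ
    have hpj : p j = ρ * p i := by
      have hn : (‖p i‖ ^ 2 : ℂ) ≠ 0 := by
        have := norm_ne_zero_iff.2 (h1 i)
        exact_mod_cast pow_ne_zero 2 this
      have h2 : star (p i) * p j = ((star (p i) * p j).re : ℂ) :=
        Complex.ext (by simp) (by rw [him]; simp)
      refine mul_left_cancel₀ (star_ne_zero.2 (h1 i)) ?_
      rw [h2, mul_left_comm, hρ, Complex.star_def, Complex.conj_mul']
      push_cast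
      rw [div_mul_cancel₀ _ hn]
    -- As `p j = ρ p i`, this real vector is orthogonal to `p`, so `v vᵀ` annihilates `p`; its only
    -- off-diagonal entries lie on the edge `ij`.
    set v : Fin n → ℝ := Pi.single i ρ - Pi.single j 1 with hv
    have hvi : v i = ρ := by simp [hv, Pi.single_eq_of_ne hij]
    have hvj : v j = -1 := by simp [hv, Pi.single_eq_of_ne hij.symm]
    have hvk : ∀ k, k ≠ i → k ≠ j → v k = 0 := by
      intro k hki hkj
      simp [hv, Pi.single_eq_of_ne hki, Pi.single_eq_of_ne hkj]
    refine ⟨Matrix.vecMulVec v v, ⟨Matrix.transpose_vecMulVec v v, ?_⟩, ?_, ?_⟩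
    · intro k l hkl hadj'
      rw [Matrix.vecMulVec_apply, mul_eq_zero]
      by_contra! h
      have hk : k = i ∨ k = j := by by_contra! hk; exact h.1 (hvk k hk.1 hk.2)
      have hl : l = i ∨ l = j := by by_contra! hl; exact h.2 (hvk l hl.1 hl.2)
      rcases hk with rfl | rfl <;> rcases hl with rfl | rfl
      · exact hkl rfl
      · exact hadj' hadj
      · exact hadj' hadj.symm
      · exact hkl rfl
    · intro h
      have := congrFun (congrFun h j) j
      rw [Matrix.vecMulVec_apply, hvj] at this
      norm_num at this
    · ext k
      rw [toC_mulVec_apply]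
      simp only [Matrix.vecMulVec_apply, Complex.ofReal_mul, mul_assoc, ← Finset.mul_sum]
      have : ∑ l, (v l : ℂ) * p l = 0 := by
        rw [Finset.sum_eq_add i j hij (fun l _ hl => by rw [hvk l hl.1 hl.2]; simp) (by simp)
          (by simp), hvi, hvj, hpj]
        push_cast; ring
      rw [this, mul_zero]; rfl
  · push Not at h1
    obtain ⟨i, hi⟩ := h1
    exact hzero i hi

theorem toC_mulVec_eq_iff (B : Matrix (Fin n) (Fin n) ℝ) (p q : Fin n → ℂ) :
    toC B *ᵥ p = q ↔ (B *ᵥ fun i => (p i).re) = (fun i => (q i).re) ∧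
      (B *ᵥ fun i => (p i).im) = fun i => (q i).im := by
  have hre : ∀ i, ((toC B *ᵥ p) i).re = (B *ᵥ fun i => (p i).re) i := by
    intro i
    rw [toC_mulVec_apply, Complex.re_sum]
    exact Finset.sum_congr rfl fun j _ => Complex.re_ofReal_mul _ _
  have him : ∀ i, ((toC B *ᵥ p) i).im = (B *ᵥ fun i => (p i).im) i := by
    intro i
    rw [toC_mulVec_apply, Complex.im_sum]
    exact Finset.sum_congr rfl fun j _ => Complex.im_ofReal_mul _ _
  constructor
  · rintro rfl
    exact ⟨funext fun i => (hre i).symm, funext fun i => (him i).symm⟩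
  · rintro ⟨h1, h2⟩
    ext i
    exact Complex.ext ((hre i).trans (congrFun h1 i)) ((him i).trans (congrFun h2 i))

theorem vecMulVec_mulVec_real (a b x : Fin n → ℝ) :
    Matrix.vecMulVec a b *ᵥ x = (b ⬝ᵥ x) • a := by
  ext i
  simp only [Matrix.mulVec, dotProduct, Matrix.vecMulVec_apply, mul_assoc, ← Finset.mul_sum]
  exact mul_comm _ _

theorem exists_symm_mulVec_eq_of_dual {a v r : Fin n → ℝ} (ha : a ⬝ᵥ v = 1) :
    ∃ B : Matrix (Fin n) (Fin n) ℝ, Bᵀ = B ∧ B *ᵥ v = r := by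
  refine ⟨Matrix.vecMulVec r a + Matrix.vecMulVec a r - (r ⬝ᵥ v) • Matrix.vecMulVec a a, ?_, ?_⟩
  · simp only [Matrix.transpose_sub, Matrix.transpose_add, Matrix.transpose_smul,
      Matrix.transpose_vecMulVec]
    rw [add_comm (Matrix.vecMulVec a r)]
  · simp only [Matrix.sub_mulVec, Matrix.add_mulVec, Matrix.smul_mulVec, vecMulVec_mulVec_real, ha]
    simp

/-- With `a, b` dual to `x, y`, the matrix `r aᵀ + s bᵀ` solves both equations. Adding its transpose
and subtracting the doubly counted part on `a, b` makes it symmetric; `hrs` is the necessary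
condition `y · B x = x · B y`. -/
theorem exists_symm_mulVec_eq_of_dual_pair {a b x y r s : Fin n → ℝ} (hax : a ⬝ᵥ x = 1)
    (hay : a ⬝ᵥ y = 0) (hbx : b ⬝ᵥ x = 0) (hby : b ⬝ᵥ y = 1) (hrs : r ⬝ᵥ y = s ⬝ᵥ x) :
    ∃ B : Matrix (Fin n) (Fin n) ℝ, Bᵀ = B ∧ B *ᵥ x = r ∧ B *ᵥ y = s := by
  refine ⟨Matrix.vecMulVec r a + Matrix.vecMulVec a r + (Matrix.vecMulVec s b + Matrix.vecMulVec b s)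
    - ((r ⬝ᵥ x) • Matrix.vecMulVec a a + (r ⬝ᵥ y) • (Matrix.vecMulVec a b + Matrix.vecMulVec b a) +
      (s ⬝ᵥ y) • Matrix.vecMulVec b b), ?_, ?_, ?_⟩
  · simp only [Matrix.transpose_sub, Matrix.transpose_add, Matrix.transpose_smul,
      Matrix.transpose_vecMulVec]
    rw [add_comm (Matrix.vecMulVec a r), add_comm (Matrix.vecMulVec b s),
      add_comm (Matrix.vecMulVec b a)]
  · simp only [Matrix.sub_mulVec, Matrix.add_mulVec, Matrix.smul_mulVec, vecMulVec_mulVec_real, hax,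
      hbx, hrs]
    ext i
    simp
  · simp only [Matrix.sub_mulVec, Matrix.add_mulVec, Matrix.smul_mulVec, vecMulVec_mulVec_real, hay,
      hby]
    ext i
    simp

theorem exists_symm_toC_mulVec_eq {p q : Fin n → ℂ} (hpq : (star p ⬝ᵥ q).im = 0)
    (h : ∀ c : ℂ, (∀ i, (c * p i).re = 0) → ∀ i, (c * q i).re = 0) :
    ∃ B : Matrix (Fin n) (Fin n) ℝ, Bᵀ = B ∧ toC B *ᵥ p = q := by
  -- Either all entries of `p` lie on one real line through 0, where `h` puts `q` on the same line,
  -- or the real and imaginary parts of `p` are independent, where `hpq` suffices.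
  by_cases hdep : ∀ i j, (star (p i) * p j).im = 0
  · by_cases hp : p = 0
    · have hq : q = 0 := by
        ext i
        apply Complex.ext
        · simpa using h 1 (by simp [hp]) i
        · simpa using h Complex.I (by simp [hp]) i
      exact ⟨0, Matrix.transpose_zero, by simp [hp, hq]⟩
    · obtain ⟨i, hi⟩ := Function.ne_iff.1 hp
      rw [Pi.zero_apply] at hi
      set v : Fin n → ℝ := fun j => (p j / p i).re with hv
      have hpv : ∀ j, p j = v j * p i := by
        intro j
        have him : (p j / p i).im = 0 := by
          have : p j / p i = star (p i) * p j * ((‖p i‖ ^ 2)⁻¹ : ℝ) := by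
            rw [div_eq_iff hi, mul_right_comm, mul_right_comm (star (p i)), Complex.star_def,
              Complex.conj_mul']
            have : (‖p i‖ : ℂ) ≠ 0 := by exact_mod_cast norm_ne_zero_iff.2 hi
            push_cast
            field_simp
          rw [this, Complex.im_mul_ofReal, hdep i j, zero_mul]
        rw [← div_eq_iff hi]
        exact Complex.ext rfl (by rw [him]; simp)
      set r : Fin n → ℝ := fun j => (q j / p i).re with hr
      have hqr : ∀ j, q j = r j * p i := by
        intro j
        have him : (q j / p i).im = 0 := by
          -- This `c` makes every `c * p k = i v k` imaginary, so `h` says that `q j / p i` is real.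
          have := h (Complex.I / p i) (fun k => by
            rw [hpv k, mul_left_comm, div_mul_cancel₀ _ hi]; simp) j
          rw [div_mul_eq_mul_div, mul_div_assoc] at this
          simpa using this
        rw [← div_eq_iff hi]
        exact Complex.ext rfl (by rw [him]; simp)
      obtain ⟨B, hB, hBv⟩ := exists_symm_mulVec_eq_of_dual (a := Pi.single i 1) (v := v) (r := r)
        (by simp [hv, div_self hi])
      refine ⟨B, hB, ?_⟩
      ext j
      rw [toC_mulVec_apply, hqr j, ← hBv]
      simp only [Matrix.mulVec, dotProduct, Complex.ofReal_sum, Finset.sum_mul, Complex.ofReal_mul]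
      refine Finset.sum_congr rfl fun k _ => ?_
      rw [hpv k, mul_assoc]
  · push Not at hdep
    obtain ⟨i, j, hij⟩ := hdep
    -- A nonzero 2×2 minor of the pair `(Re p, Im p)`; Cramer's rule on the rows `i, j` gives the
    -- dual vectors `a, b` below.
    set m : ℝ := (star (p i) * p j).im with hm
    have hm' : m = (p i).re * (p j).im - (p i).im * (p j).re := by
      rw [hm]; simp; ring
    obtain ⟨B, hB, h1, h2⟩ := exists_symm_mulVec_eq_of_dual_pair
      (a := m⁻¹ • (Pi.single i (p j).im - Pi.single j (p i).im))
      (b := m⁻¹ • (Pi.single j (p i).re - Pi.single i (p j).re))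
      (x := fun i => (p i).re) (y := fun i => (p i).im) (r := fun i => (q i).re)
      (s := fun i => (q i).im)
      (by
        simp only [smul_dotProduct, sub_dotProduct, single_dotProduct, smul_eq_mul]
        rw [hm'] at hij ⊢
        field_simp)
      (by simp only [smul_dotProduct, sub_dotProduct, single_dotProduct, smul_eq_mul]; ring)
      (by simp only [smul_dotProduct, sub_dotProduct, single_dotProduct, smul_eq_mul]; ring)
      (by
        simp only [smul_dotProduct, sub_dotProduct, single_dotProduct, smul_eq_mul]
        rw [hm'] at hij ⊢
        field_simp)
      (by
        have h1 : (star p ⬝ᵥ q).im = (fun i => (q i).im) ⬝ᵥ (fun i => (p i).re) -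
            (fun i => (q i).re) ⬝ᵥ (fun i => (p i).im) := by
          simp only [dotProduct, Complex.im_sum, ← Finset.sum_sub_distrib]
          refine Finset.sum_congr rfl fun k _ => ?_
          simp
          ring
        rw [h1] at hpq
        linarith)
    exact ⟨B, hB, (toC_mulVec_eq_iff B p q).2 ⟨h1, h2⟩⟩

end SymmetricSystem

/-! ### Real matrices acting on complex vectors -/

section RealMatrix

variable {n : ℕ}

theorem toC_mulVec_re (B : Matrix (Fin n) (Fin n) ℝ) (z : Fin n → ℂ) :
    (fun i => ((toC B *ᵥ z) i).re) = B *ᵥ fun i => (z i).re :=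
  ((toC_mulVec_eq_iff B z _).1 rfl).1.symm

theorem toC_mul (A B : Matrix (Fin n) (Fin n) ℝ) : toC (A * B) = toC A * toC B :=
  Matrix.map_mul (f := Complex.ofRealHom)

theorem toC_one : toC (1 : Matrix (Fin n) (Fin n) ℝ) = 1 :=
  Matrix.map_one _ Complex.ofReal_zero Complex.ofReal_one

theorem toC_smul_mulVec (r : ℝ) (A : Matrix (Fin n) (Fin n) ℝ) (z : Fin n → ℂ) :
    toC (r • A) *ᵥ z = (r : ℂ) • (toC A *ᵥ z) := by
  rw [← Matrix.smul_mulVec]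
  congr 1
  ext i j
  simp [toC]

theorem toC_conjTranspose (A : Matrix (Fin n) (Fin n) ℝ) : (toC A)ᴴ = toC Aᵀ := by
  ext i j
  simp [toC]

theorem star_dotProduct_toC_mulVec_im {B : Matrix (Fin n) (Fin n) ℝ} (hB : Bᵀ = B)
    (z : Fin n → ℂ) : (star z ⬝ᵥ (toC B *ᵥ z)).im = 0 := by
  have h : star (star z ⬝ᵥ (toC B *ᵥ z)) = star z ⬝ᵥ (toC B *ᵥ z) := by
    rw [← Matrix.star_dotProduct_star, star_star, Matrix.star_mulVec, toC_conjTranspose, hB,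
      ← Matrix.dotProduct_mulVec]
  exact Complex.conj_eq_iff_im.1 h

/-- The Hermitian form of a symmetric matrix with positive definite real part has positive real
part. -/
theorem re_star_dotProduct_mulVec_pos {ι : Type*} [Fintype ι] {Y : Matrix ι ι ℂ} (hs : Yᵀ = Y)
    (hY : (Y.map Complex.re).PosDef) {z : ι → ℂ} (hz : z ≠ 0) :
    0 < (star z ⬝ᵥ (Y *ᵥ z)).re := by
  set a : ι → ℝ := fun i => (z i).re with ha
  set b : ι → ℝ := fun i => (z i).im with hb
  -- The contribution of `Im Y` pairs a symmetric matrix with an antisymmetric one.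
  have hcross : ∑ i, ∑ j, (Y i j).im * (a i * b j - b i * a j) = 0 := by
    have : ∑ i, ∑ j, (Y i j).im * (a i * b j - b i * a j) =
        -∑ i, ∑ j, (Y i j).im * (a i * b j - b i * a j) := by
      conv_lhs => rw [Finset.sum_comm]
      simp only [← Finset.sum_neg_distrib]
      refine Finset.sum_congr rfl fun i _ => Finset.sum_congr rfl fun j _ => ?_
      have : Y j i = Y i j := congrFun (congrFun hs i) j
      rw [this]
      ring
    linarith
  have hform : (star z ⬝ᵥ (Y *ᵥ z)).re =
      a ⬝ᵥ (Y.map Complex.re *ᵥ a) + b ⬝ᵥ (Y.map Complex.re *ᵥ b) := by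
    rw [← sub_zero (a ⬝ᵥ _ + _), ← hcross]
    simp only [dotProduct, Matrix.mulVec, Complex.re_sum, Finset.mul_sum,
      ← Finset.sum_add_distrib, ← Finset.sum_sub_distrib]
    refine Finset.sum_congr rfl fun i _ => Finset.sum_congr rfl fun j _ => ?_
    simp [ha, hb]
    ring
  rw [hform]
  have hnn : ∀ x : ι → ℝ, 0 ≤ x ⬝ᵥ (Y.map Complex.re *ᵥ x) := fun x => by
    simpa using hY.posSemidef.dotProduct_mulVec_nonneg x
  have hpos : ∀ x : ι → ℝ, x ≠ 0 → 0 < x ⬝ᵥ (Y.map Complex.re *ᵥ x) := fun x hx => by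
    simpa using hY.dotProduct_mulVec_pos hx
  by_cases h : a = 0
  · have hb0 : b ≠ 0 := by
      intro hb0
      refine hz (funext fun i => Complex.ext ?_ ?_)
      · exact congrFun h i
      · exact congrFun hb0 i
    exact add_pos_of_nonneg_of_pos (hnn a) (hpos b hb0)
  · exact add_pos_of_pos_of_nonneg (hpos a h) (hnn b)

end RealMatrix

namespace Network

variable {NT NI NR : ℕ} (net : Network NT NI NR)

/-! ### The matrices of the network -/

theorem Y_mulVec_elim (x : Fin NI → ℂ) (y : Fin NR → ℂ) :
    star (Sum.elim 0 (Sum.elim x y) : Fin NT ⊕ Fin NI ⊕ Fin NR → ℂ) ⬝ᵥ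
        (net.Y *ᵥ Sum.elim 0 (Sum.elim x y)) =
      star x ⬝ᵥ (net.YII *ᵥ x + net.YIR *ᵥ y) + star y ⬝ᵥ (net.YRI *ᵥ x + net.YRR *ᵥ y) := by
  simp [dotProduct, Matrix.mulVec, Fintype.sum_sum_type, YII, YIR, YRI, YRR]

theorem star_dotProduct_diagonal_yR_re_nonneg (y : Fin NR → ℂ) :
    0 ≤ (star y ⬝ᵥ (Matrix.diagonal net.yR *ᵥ y)).re := by
  rw [dotProduct, Complex.re_sum]
  refine Finset.sum_nonneg fun i _ => ?_
  rw [Matrix.mulVec_diagonal, Pi.star_apply, mul_left_comm, Complex.star_def, Complex.conj_mul',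
    ← Complex.ofReal_pow, Complex.re_mul_ofReal]
  have := net.yR_re_pos i
  positivity

/-- On a nonzero kernel vector the form of `Y_RR` would have positive real part and that of the
loads nonnegative real part, yet their sum is zero. -/
theorem isUnit_load : IsUnit (Matrix.diagonal net.yR + net.YRR) := by
  rw [← Matrix.mulVec_injective_iff_isUnit, ← Matrix.coe_mulVecLin, injective_iff_map_eq_zero]
  intro y hy
  rw [Matrix.mulVecLin_apply] at hy
  by_contra hy0
  have hz : (Sum.elim 0 (Sum.elim 0 y) : Fin NT ⊕ Fin NI ⊕ Fin NR → ℂ) ≠ 0 := by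
    intro h
    exact hy0 (funext fun i => congrFun h (.inr (.inr i)))
  have h1 := re_star_dotProduct_mulVec_pos net.symm net.re_posDef hz
  rw [Y_mulVec_elim] at h1
  have h2 : star y ⬝ᵥ ((Matrix.diagonal net.yR + net.YRR) *ᵥ y) = 0 := by rw [hy, dotProduct_zero]
  rw [Matrix.add_mulVec, dotProduct_add] at h2
  have h3 := congrArg Complex.re h2
  have h4 := net.star_dotProduct_diagonal_yR_re_nonneg y
  simp only [star_zero, zero_dotProduct, Matrix.mulVec_zero, zero_add] at h1
  rw [Complex.add_re, Complex.zero_re] at h3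
  linarith

theorem load_mul_loadInv : (Matrix.diagonal net.yR + net.YRR) * net.loadInv = 1 :=
  Matrix.mul_nonsing_inv _ ((Matrix.isUnit_iff_isUnit_det _).1 net.isUnit_load)

theorem Y_symm_apply (a b) : net.Y a b = net.Y b a := congrFun (congrFun net.symm b) a

theorem barYII_transpose : net.barYIIᵀ = net.barYII := by
  have h1 : net.YIIᵀ = net.YII := by ext i j; exact net.Y_symm_apply _ _
  have h2 : net.YIRᵀ = net.YRI := by ext i j; exact net.Y_symm_apply _ _
  have h3 : net.YRIᵀ = net.YIR := by ext i j; exact net.Y_symm_apply _ _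
  have h4 : net.YRRᵀ = net.YRR := by ext i j; exact net.Y_symm_apply _ _
  unfold barYII loadInv
  rw [Matrix.transpose_sub, Matrix.transpose_mul, Matrix.transpose_mul,
    Matrix.transpose_nonsing_inv, Matrix.transpose_add, Matrix.diagonal_transpose, h1, h2, h3, h4,
    Matrix.mul_assoc]

theorem imYII_transpose : net.imYIIᵀ = net.imYII := by
  unfold imYII
  rw [← Matrix.transpose_map, barYII_transpose]

theorem reYII_transpose : net.reYIIᵀ = net.reYII := by
  unfold reYII
  rw [← Matrix.transpose_map, barYII_transpose]

theorem reYII_posDef : net.reYII.PosDef := by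
  refine Matrix.PosDef.of_dotProduct_mulVec_pos net.reYII_transpose fun x hx => ?_
  set z : Fin NI → ℂ := fun i => (x i : ℂ) with hz
  -- Schur complement argument: for this `y`, the form of `barYII` at `z` equals the form of `Y` at
  -- `(0, z, y)` plus the load form at `y`.
  set y : Fin NR → ℂ := -(net.loadInv *ᵥ (net.YRI *ᵥ z)) with hy
  have hne : (Sum.elim 0 (Sum.elim z y) : Fin NT ⊕ Fin NI ⊕ Fin NR → ℂ) ≠ 0 := by
    intro h
    refine hx (funext fun i => ?_)
    have := congrFun h (.inr (.inl i))
    simpa [hz] using this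
  have h1 := re_star_dotProduct_mulVec_pos net.symm net.re_posDef hne
  rw [Y_mulVec_elim] at h1
  have hI : net.YII *ᵥ z + net.YIR *ᵥ y = net.barYII *ᵥ z := by
    unfold barYII
    rw [hy, Matrix.mulVec_neg, Matrix.sub_mulVec, ← Matrix.mulVec_mulVec, ← Matrix.mulVec_mulVec,
      sub_eq_add_neg]
  have hR : net.YRI *ᵥ z + net.YRR *ᵥ y = -(Matrix.diagonal net.yR *ᵥ y) := by
    have h2 : (Matrix.diagonal net.yR + net.YRR) *ᵥ y = -(net.YRI *ᵥ z) := by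
      rw [hy, Matrix.mulVec_neg, Matrix.mulVec_mulVec, load_mul_loadInv, Matrix.one_mulVec]
    rw [Matrix.add_mulVec] at h2
    rw [eq_neg_iff_add_eq_zero, add_assoc, add_comm (net.YRR *ᵥ y), h2, add_neg_cancel]
  have h3 := net.star_dotProduct_diagonal_yR_re_nonneg y
  have h4 : (star z ⬝ᵥ (net.barYII *ᵥ z)).re = star x ⬝ᵥ (net.reYII *ᵥ x) := by
    simp [dotProduct, Matrix.mulVec, hz, reYII]
  rw [hI, hR, dotProduct_neg, Complex.add_re, Complex.neg_re, h4] at h1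
  linarith

theorem invSqrt_transpose : (invSqrt net.reYII)ᵀ = invSqrt net.reYII :=
  (invSqrt_spec net.reYII_posDef).1.isHermitian

theorem invSqrt_mul_inv : invSqrt net.reYII * (invSqrt net.reYII)⁻¹ = 1 :=
  Matrix.mul_nonsing_inv _
    ((Matrix.isUnit_iff_isUnit_det _).1 (invSqrt_spec net.reYII_posDef).1.isUnit)

theorem inv_mul_invSqrt : (invSqrt net.reYII)⁻¹ * invSqrt net.reYII = 1 :=
  Matrix.nonsing_inv_mul _
    ((Matrix.isUnit_iff_isUnit_det _).1 (invSqrt_spec net.reYII_posDef).1.isUnit)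

theorem barB_transpose {B : Matrix (Fin NI) (Fin NI) ℝ} (hB : Bᵀ = B) :
    (net.barB B)ᵀ = net.barB B := by
  unfold barB
  rw [Matrix.transpose_smul, Matrix.transpose_mul, Matrix.transpose_mul, Matrix.transpose_add, hB,
    imYII_transpose, invSqrt_transpose, Matrix.mul_assoc]

/-! ### The virtual scattering matrix -/

theorem barTheta_denom_mulVec (Bbar : Matrix (Fin NI) (Fin NI) ℝ) (v : Fin NI → ℂ) :
    ((net.Y0 : ℂ) • (1 : Matrix (Fin NI) (Fin NI) ℂ) + Complex.I • toC Bbar) *ᵥ v =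
      (net.Y0 : ℂ) • v + Complex.I • (toC Bbar *ᵥ v) := by
  rw [Matrix.add_mulVec, Matrix.smul_mulVec, Matrix.smul_mulVec, Matrix.one_mulVec]

theorem barTheta_num_mulVec (Bbar : Matrix (Fin NI) (Fin NI) ℝ) (v : Fin NI → ℂ) :
    ((net.Y0 : ℂ) • (1 : Matrix (Fin NI) (Fin NI) ℂ) - Complex.I • toC Bbar) *ᵥ v =
      (net.Y0 : ℂ) • v - Complex.I • (toC Bbar *ᵥ v) := by
  rw [Matrix.sub_mulVec, Matrix.smul_mulVec, Matrix.smul_mulVec, Matrix.one_mulVec]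

/-- The form `vᴴ (Y0 + i Bbar) v` has real part `Y0 ‖v‖²`, since `vᴴ Bbar v` is real. -/
theorem isUnit_barTheta_denom {Bbar : Matrix (Fin NI) (Fin NI) ℝ} (hB : Bbarᵀ = Bbar) :
    IsUnit ((net.Y0 : ℂ) • (1 : Matrix (Fin NI) (Fin NI) ℂ) + Complex.I • toC Bbar) := by
  rw [← Matrix.mulVec_injective_iff_isUnit, ← Matrix.coe_mulVecLin, injective_iff_map_eq_zero]
  intro v hv
  rw [Matrix.mulVecLin_apply, barTheta_denom_mulVec] at hv
  have h1 : star v ⬝ᵥ ((net.Y0 : ℂ) • v + Complex.I • (toC Bbar *ᵥ v)) = 0 := by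
    rw [hv, dotProduct_zero]
  rw [dotProduct_add, dotProduct_smul, dotProduct_smul, star_dotProduct_self] at h1
  have h2 := congrArg Complex.re h1
  simp only [smul_eq_mul, Complex.add_re, Complex.I_mul_re, star_dotProduct_toC_mulVec_im hB,
    ← Complex.ofReal_mul, Complex.ofReal_re, Complex.zero_re, neg_zero, add_zero] at h2
  exact l2_eq_zero.1 (pow_eq_zero_iff two_ne_zero |>.1
    ((mul_eq_zero.1 h2).resolve_left net.Y0_pos.ne'))

/-- Clearing the denominator of the Cayley transform and collecting the terms with `Bbar` makes the
equation linear in `Bbar`. -/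
theorem eq_barTheta_mulVec_iff {Bbar : Matrix (Fin NI) (Fin NI) ℝ} (hB : Bbarᵀ = Bbar)
    (u a : Fin NI → ℂ) : u = net.barTheta Bbar *ᵥ a ↔
      toC Bbar *ᵥ (u + a) = (Complex.I * net.Y0) • (u - a) := by
  have hdet := (Matrix.isUnit_iff_isUnit_det _).1 (net.isUnit_barTheta_denom hB)
  have h1 : u = net.barTheta Bbar *ᵥ a ↔ (net.Y0 : ℂ) • u + Complex.I • (toC Bbar *ᵥ u) =
      (net.Y0 : ℂ) • a - Complex.I • (toC Bbar *ᵥ a) := by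
    unfold barTheta
    rw [← barTheta_denom_mulVec, ← barTheta_num_mulVec, ← Matrix.mulVec_mulVec]
    constructor
    · intro h
      conv_lhs => rw [h]
      rw [Matrix.mulVec_mulVec, Matrix.mul_nonsing_inv _ hdet, Matrix.one_mulVec]
    · intro h
      rw [← h, Matrix.mulVec_mulVec, Matrix.nonsing_inv_mul _ hdet, Matrix.one_mulVec]
  rw [h1, Matrix.mulVec_add]
  constructor
  · intro h
    ext i
    have := congrFun h i
    simp only [Pi.add_apply, Pi.sub_apply, Pi.smul_apply, smul_eq_mul] at this ⊢
    linear_combination (-Complex.I) * this +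
      ((toC Bbar *ᵥ u) i + (toC Bbar *ᵥ a) i) * Complex.I_mul_I
  · intro h
    ext i
    have := congrFun h i
    simp only [Pi.add_apply, Pi.sub_apply, Pi.smul_apply, smul_eq_mul] at this ⊢
    linear_combination Complex.I * this + net.Y0 * (u i - a i) * Complex.I_mul_I

/-- Pair the linear equation with `u + a`: the left side is real, and the imaginary part of the
right side is `Y0 (‖u‖² - ‖a‖²)`. -/
theorem l2_barTheta_mulVec {Bbar : Matrix (Fin NI) (Fin NI) ℝ} (hB : Bbarᵀ = Bbar)
    (a : Fin NI → ℂ) : l2 (net.barTheta Bbar *ᵥ a) = l2 a := by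
  set u := net.barTheta Bbar *ᵥ a with hu
  have h1 := (net.eq_barTheta_mulVec_iff hB u a).1 hu
  have h2 := star_dotProduct_toC_mulVec_im hB (u + a)
  rw [h1, dotProduct_smul, smul_eq_mul, mul_assoc, Complex.I_mul_im, Complex.re_ofReal_mul,
    re_star_add_dotProduct_sub] at h2
  exact (sq_eq_sq₀ (l2_nonneg _) (l2_nonneg _)).1
    (sub_eq_zero.1 ((mul_eq_zero.1 h2).resolve_left net.Y0_pos.ne'))

/-! ### The recovery system as a linear system for the susceptance matrix -/

/-- The right-hand side of the linear system for the susceptance matrix. -/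
noncomputable def recoveryRhs (u a : Fin NI → ℂ) : Fin NI → ℂ :=
  Complex.I • (toC (invSqrt net.reYII)⁻¹ *ᵥ (u - a)) -
    toC net.imYII *ᵥ (toC (invSqrt net.reYII) *ᵥ (u + a))

theorem eq_barTheta_barB_mulVec_iff {B : Matrix (Fin NI) (Fin NI) ℝ} (hB : Bᵀ = B)
    (u a : Fin NI → ℂ) : u = net.barTheta (net.barB B) *ᵥ a ↔
      toC B *ᵥ (toC (invSqrt net.reYII) *ᵥ (u + a)) = net.recoveryRhs u a := by
  have hY0 : (net.Y0 : ℂ) ≠ 0 := by exact_mod_cast net.Y0_pos.ne'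
  set p := toC (invSqrt net.reYII) *ᵥ (u + a) with hp
  rw [net.eq_barTheta_mulVec_iff (net.barB_transpose hB)]
  unfold recoveryRhs barB
  rw [eq_sub_iff_add_eq, ← toC_add_mulVec, toC_smul_mulVec, toC_mul, toC_mul,
    ← Matrix.mulVec_mulVec, ← Matrix.mulVec_mulVec, ← hp, mul_comm Complex.I, mul_smul,
    smul_right_inj hY0]
  generalize toC (B + net.imYII) *ᵥ p = y
  constructor
  · intro h
    rw [← Matrix.mulVec_smul, ← h, Matrix.mulVec_mulVec, ← toC_mul, inv_mul_invSqrt, toC_one,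
      Matrix.one_mulVec]
  · intro h
    rw [h, Matrix.mulVec_smul, Matrix.mulVec_mulVec, ← toC_mul, invSqrt_mul_inv, toC_one,
      Matrix.one_mulVec]

theorem recoveryRhs_compatible {u a : Fin NI → ℂ} (h : l2 u = l2 a) :
    (star (toC (invSqrt net.reYII) *ᵥ (u + a)) ⬝ᵥ net.recoveryRhs u a).im = 0 := by
  unfold recoveryRhs
  rw [dotProduct_sub, Complex.sub_im, star_dotProduct_toC_mulVec_im net.imYII_transpose, sub_zero,
    dotProduct_smul, Matrix.star_mulVec, toC_conjTranspose, invSqrt_transpose,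
    ← Matrix.dotProduct_mulVec, Matrix.mulVec_mulVec, ← toC_mul, invSqrt_mul_inv, toC_one,
    Matrix.one_mulVec, smul_eq_mul, Complex.I_mul_im, re_star_add_dotProduct_sub, h, sub_self]

theorem mem_recovery_iff {G : SimpleGraph (Fin NI)} {w : Fin NT → ℂ} {u : Fin NI → ℂ}
    {t : Config NI} : t ∈ net.recovery G w u ↔
      t ∈ net.configs G ∧ toC t.B *ᵥ net.recoveryVec w u = net.recoveryRhs u (net.HIT *ᵥ w) := by
  unfold recovery recoveryVec
  rw [Set.mem_ofPred_eq, and_comm]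
  refine and_congr_right fun ht => ?_
  rw [← net.eq_barTheta_barB_mulVec_iff ht.2.2.1, ht.1, ht.2.1]

/-- The configuration with a given susceptance matrix. -/
noncomputable def configOf (B : Matrix (Fin NI) (Fin NI) ℝ) : Config NI :=
  ⟨net.barTheta (net.barB B), net.barB B, B⟩

theorem configOf_mem {G : SimpleGraph (Fin NI)} {B : Matrix (Fin NI) (Fin NI) ℝ}
    (hB : B ∈ archSet G) : net.configOf B ∈ net.configs G := ⟨rfl, rfl, hB⟩

theorem eq_configOf {G : SimpleGraph (Fin NI)} {t : Config NI} (ht : t ∈ net.configs G) :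
    t = net.configOf t.B := by
  obtain ⟨Θ, Bbar, B⟩ := t
  obtain ⟨h1, h2, -⟩ := ht
  simp only at h1 h2
  subst h2
  subst h1
  rfl

theorem l2_config_mulVec {G : SimpleGraph (Fin NI)} {t : Config NI} (ht : t ∈ net.configs G)
    (a : Fin NI → ℂ) : l2 (t.Θ *ᵥ a) = l2 a := by
  obtain ⟨h1, h2, h3, -⟩ := ht
  rw [h1]
  exact net.l2_barTheta_mulVec (by rw [h2]; exact net.barB_transpose h3) a

theorem existsUnique_recovery_iff {G : SimpleGraph (Fin NI)} (hG : G.IsTree) {w : Fin NT → ℂ}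
    {u : Fin NI → ℂ} (hwu : (w, u) ∈ relaxSet NI net.HIT) :
    (∃! t, t ∈ net.recovery G w u) ↔ net.NonDegenerate G w u := by
  constructor
  · rintro ⟨t, ht, huniq⟩
    by_contra hdeg
    -- A homogeneous solution, which added to `t.B` gives a second configuration.
    obtain ⟨B, hB, hB0, hBp⟩ := exists_ne_zero_of_not_nonDegenerate hdeg
    obtain ⟨htc, htB⟩ := net.mem_recovery_iff.1 ht
    have harch : t.B + B ∈ archSet G := by
      refine ⟨by rw [Matrix.transpose_add, htc.2.2.1, hB.1], fun i j hij h => ?_⟩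
      rw [Matrix.add_apply, htc.2.2.2 i j hij h, hB.2 i j hij h, add_zero]
    have hmem : net.configOf (t.B + B) ∈ net.recovery G w u := by
      rw [mem_recovery_iff]
      refine ⟨net.configOf_mem harch, ?_⟩
      rw [← htB]
      change toC (t.B + B) *ᵥ _ = _
      rw [toC_add_mulVec, hBp, add_zero]
    have h1 : t.B + B = t.B := congrArg Config.B (huniq _ hmem)
    exact hB0 (left_eq_add.1 h1.symm)
  · intro hnd
    obtain ⟨B, hB, hBp⟩ := exists_mem_archSet_of_nonDegenerate hG.connected hnd
      (net.recoveryRhs_compatible hwu.1)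
    refine ⟨net.configOf B, net.mem_recovery_iff.2 ⟨net.configOf_mem hB, hBp⟩, ?_⟩
    intro t ht
    obtain ⟨htc, htB⟩ := net.mem_recovery_iff.1 ht
    have h0 : t.B - B = 0 := by
      refine eq_zero_of_toC_mulVec_eq_zero hG.isAcyclic hnd ⟨?_, fun i j hij h => ?_⟩ ?_
      · rw [Matrix.transpose_sub, htc.2.2.1, hB.1]
      · rw [Matrix.sub_apply, htc.2.2.2 i j hij h, hB.2 i j hij h, sub_zero]
      · rw [toC_sub_mulVec]
        exact sub_eq_zero.2 (htB.trans hBp.symm)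
    rw [net.eq_configOf htc, sub_eq_zero.1 h0]

theorem mul_toC_mulVec_re (B : Matrix (Fin NI) (Fin NI) ℝ) (c : ℂ) (z : Fin NI → ℂ) :
    (fun i => (c * (toC B *ᵥ z) i).re) = B *ᵥ fun i => (c * z i).re := by
  rw [← toC_mulVec_re B fun i => c * z i]
  ext i
  rw [show (fun i => c * z i) = c • z from rfl, Matrix.mulVec_smul]
  rfl

theorem mul_recoveryVec_re_eq_zero_iff (c : ℂ) (v : Fin NI → ℂ) :
    (∀ i, (c * (toC (invSqrt net.reYII) *ᵥ v) i).re = 0) ↔ ∀ i, (c * v i).re = 0 := by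
  have h := mul_toC_mulVec_re (invSqrt net.reYII) c v
  constructor
  · intro h0
    have h1 : invSqrt net.reYII *ᵥ (fun i => (c * v i).re) = 0 := by
      rw [← h]; exact funext h0
    have h2 : (fun i => (c * v i).re) = 0 := by
      rw [← Matrix.one_mulVec (fun i => (c * v i).re), ← net.inv_mul_invSqrt,
        ← Matrix.mulVec_mulVec, h1, Matrix.mulVec_zero]
    exact congrFun h2
  · intro h0
    have h1 : (fun i => (c * v i).re) = 0 := funext h0
    rw [h1, Matrix.mulVec_zero] at h
    exact congrFun h

/-- Under `hc` the term with `imYII` drops out, because a real matrix commutes with `z ↦ Re (c z)`.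
What remains is an invertible real matrix applied to `-Im (c (u - a))`. -/
theorem mul_recoveryRhs_re_eq_zero_iff {c : ℂ} {u a : Fin NI → ℂ}
    (hc : ∀ i, (c * (u i + a i)).re = 0) :
    (∀ i, (c * net.recoveryRhs u a i).re = 0) ↔ ∀ i, (c * (u i - a i)).im = 0 := by
  have h0 := funext ((net.mul_recoveryVec_re_eq_zero_iff c (u + a)).2 hc)
  have h1 := mul_toC_mulVec_re net.imYII c (toC (invSqrt net.reYII) *ᵥ (u + a))
  rw [h0, ← Pi.zero_def, Matrix.mulVec_zero] at h1
  set T := (invSqrt net.reYII)⁻¹ with hT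
  have h2 := mul_toC_mulVec_re T (c * Complex.I) (u - a)
  have h3 : (fun i => (c * net.recoveryRhs u a i).re) =
      -(T *ᵥ fun i => (c * (u i - a i)).im) := by
    have h4 : (fun i => (c * Complex.I * (u - a) i).re) = -fun i => (c * (u i - a i)).im := by
      ext i
      rw [mul_right_comm, Complex.mul_I_re]
      rfl
    rw [h4, Matrix.mulVec_neg] at h2
    rw [← h2]
    ext i
    have h5 := congrFun h1 i
    rw [Pi.zero_apply] at h5
    unfold recoveryRhs
    rw [Pi.sub_apply, mul_sub, Complex.sub_re, h5, sub_zero, Pi.smul_apply, smul_eq_mul, mul_assoc]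
  constructor
  · intro h
    have h4 : T *ᵥ (fun i => (c * (u i - a i)).im) = 0 := by
      rw [← neg_eq_zero, ← h3]; exact funext h
    have h5 : (fun i => (c * (u i - a i)).im) = 0 := by
      rw [← Matrix.one_mulVec (fun i => (c * (u i - a i)).im), ← net.invSqrt_mul_inv,
        ← Matrix.mulVec_mulVec, h4, Matrix.mulVec_zero]
    exact congrFun h5
  · intro h
    have h4 : (fun i => (c * (u i - a i)).im) = 0 := funext h
    rw [h4, Matrix.mulVec_zero, neg_zero] at h3
    exact congrFun h3

/-- Necessity: `Re (c p) = 0` forces `Re (c B p) = 0` for real `B`. Sufficiency is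
`exists_symm_toC_mulVec_eq`, as the complete graph imposes no zeros. -/
theorem exists_recovery_top_iff {w : Fin NT → ℂ} {u : Fin NI → ℂ}
    (hwu : (w, u) ∈ relaxSet NI net.HIT) :
    (∃ t, t ∈ net.recovery ⊤ w u) ↔
      ∀ c : ℂ, (∀ i, (c * (u i + (net.HIT *ᵥ w) i)).re = 0) →
        ∀ i, (c * (u i - (net.HIT *ᵥ w) i)).im = 0 := by
  constructor
  · rintro ⟨t, ht⟩ c hc
    have h1 := (net.mem_recovery_iff.1 ht).2
    rw [← net.mul_recoveryRhs_re_eq_zero_iff hc, ← h1]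
    have h2 := mul_toC_mulVec_re t.B c (net.recoveryVec w u)
    have h3 : (fun i => (c * net.recoveryVec w u i).re) = 0 :=
      funext ((net.mul_recoveryVec_re_eq_zero_iff c (u + net.HIT *ᵥ w)).2 hc)
    rw [h3, Matrix.mulVec_zero] at h2
    exact congrFun h2
  · intro h
    obtain ⟨B, hB, hBp⟩ := exists_symm_toC_mulVec_eq (net.recoveryRhs_compatible hwu.1) (by
      intro c hc
      have hc' := (net.mul_recoveryVec_re_eq_zero_iff c (u + net.HIT *ᵥ w)).1 hc
      exact (net.mul_recoveryRhs_re_eq_zero_iff hc').2 (h c hc'))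
    refine ⟨net.configOf B, net.mem_recovery_iff.2 ⟨net.configOf_mem ⟨hB, ?_⟩, hBp⟩⟩
    intro i j hij hadj
    exact absurd hij (by simpa using hadj)

end Network

/-! ### Density of the recoverable vectors -/

section Density

variable {n : ℕ}

theorem VecNonDegenerate.mono {G G' : SimpleGraph (Fin n)} (h : G ≤ G') {p : Fin n → ℂ}
    (hp : VecNonDegenerate G' p) : VecNonDegenerate G p :=
  ⟨hp.1, fun i j hij => hp.2 i j (h hij)⟩

theorem VecNonDegenerate.smul {G : SimpleGraph (Fin n)} {p : Fin n → ℂ}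
    (hp : VecNonDegenerate G p) {c : ℂ} (hc : c ≠ 0) : VecNonDegenerate G (c • p) := by
  refine ⟨fun i => ?_, fun i j hij => ?_⟩
  · rw [Pi.smul_apply, smul_eq_mul]
    exact mul_ne_zero hc (hp.1 i)
  · have h : star ((c • p) i) * (c • p) j = ((‖c‖ ^ 2 : ℝ) : ℂ) * (star (p i) * p j) := by
      rw [Pi.smul_apply, Pi.smul_apply, smul_eq_mul, smul_eq_mul, star_mul', Complex.ofReal_pow,
        ← Complex.conj_mul', ← Complex.star_def]
      ring
    rw [h, Complex.im_ofReal_mul]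
    exact mul_ne_zero (pow_ne_zero 2 (norm_ne_zero_iff.2 hc)) (hp.2 i j hij)

theorem eventually_quadratic_ne_zero {α β γ : ℝ} (h : ¬(β = 0 ∧ γ = 0)) :
    ∀ᶠ t : ℝ in nhdsWithin (0 : ℝ) {0}ᶜ, α + β * t + γ * t ^ 2 ≠ 0 := by
  set P : Polynomial ℝ := Polynomial.C γ * Polynomial.X ^ 2 + Polynomial.C β * Polynomial.X +
    Polynomial.C α with hP
  have hP0 : P ≠ 0 := by
    intro h0
    refine h ⟨?_, ?_⟩
    · have := congrArg (fun Q => Polynomial.coeff Q 1) h0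
      simpa [hP, Polynomial.coeff_X, Polynomial.coeff_C] using this
    · have := congrArg (fun Q => Polynomial.coeff Q 2) h0
      simpa [hP, Polynomial.coeff_X, Polynomial.coeff_C] using this
  have hcl : IsClosed ((P.roots.toFinset : Set ℝ) \ {0}) :=
    ((Finset.finite_toSet _).subset Set.sdiff_subset).isClosed
  have hmem : ((P.roots.toFinset : Set ℝ) \ {0})ᶜ ∈ nhds (0 : ℝ) :=
    hcl.isOpen_compl.mem_nhds (by simp)
  filter_upwards [mem_nhdsWithin_of_mem_nhds hmem, self_mem_nhdsWithin] with t ht ht0 hroot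
  refine ht ⟨?_, ht0⟩
  rw [Finset.mem_coe, Multiset.mem_toFinset, Polynomial.mem_roots hP0, Polynomial.IsRoot.def]
  simp only [hP, Polynomial.eval_add, Polynomial.eval_mul, Polynomial.eval_C, Polynomial.eval_pow,
    Polynomial.eval_X]
  linarith

/-- A vector whose entries are pairwise linearly independent over the reals. -/
noncomputable def genericVec (n : ℕ) : Fin n → ℂ := fun j => ⟨1, (j.val : ℝ)⟩

theorem eventually_nonDegenerate_add_smul_genericVec (x : Fin n → ℂ) :
    ∀ᶠ t : ℝ in nhdsWithin (0 : ℝ) {0}ᶜ, VecNonDegenerate ⊤ (x + (t : ℂ) • genericVec n) := by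
  have h1 : ∀ i, ∀ᶠ t : ℝ in nhdsWithin (0 : ℝ) {0}ᶜ, (x + (t : ℂ) • genericVec n) i ≠ 0 := by
    intro i
    filter_upwards [eventually_quadratic_ne_zero (α := (x i).re) (β := 1) (γ := 0) (by simp)]
      with t ht h0
    refine ht ?_
    have := congrArg Complex.re h0
    simpa [genericVec] using this
  have h2 : ∀ i j, i ≠ j → ∀ᶠ t : ℝ in nhdsWithin (0 : ℝ) {0}ᶜ,
      (star ((x + (t : ℂ) • genericVec n) i) * (x + (t : ℂ) • genericVec n) j).im ≠ 0 := by
    intro i j hij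
    have hne : ((j.val : ℝ) - (i.val : ℝ)) ≠ 0 := by
      rw [sub_ne_zero]
      exact_mod_cast fun h : j.val = i.val => hij (Fin.ext h.symm)
    filter_upwards [eventually_quadratic_ne_zero (α := (star (x i) * x j).im)
      (β := (x i).re * j.val + (x j).im - (x i).im - (x j).re * i.val)
      (γ := (j.val : ℝ) - (i.val : ℝ)) (fun h => hne h.2)] with t ht h0
    refine ht ?_
    rw [← h0]
    simp [genericVec]
    ring
  filter_upwards [Filter.eventually_all.2 h1, Filter.eventually_all.2 fun i =>
    Filter.eventually_all.2 fun j => Filter.eventually_imp_distrib_left.2 (h2 i j)] with t ht1 ht2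
  exact ⟨ht1, fun i j hij => ht2 i j (by simpa using hij)⟩

theorem mem_closure_of_eventually_line {s : Set (Fin n → ℂ)} {d e : Fin n → ℂ}
    (h : ∀ᶠ t : ℝ in nhdsWithin (0 : ℝ) {0}ᶜ, d + (t : ℂ) • e ∈ s) : d ∈ closure s := by
  have hc : Continuous fun t : ℝ => d + (t : ℂ) • e := by fun_prop
  have ht : Filter.Tendsto (fun t : ℝ => d + (t : ℂ) • e) (nhdsWithin (0 : ℝ) {0}ᶜ) (nhds d) := by
    have := hc.tendsto 0
    simp only [Complex.ofReal_zero, zero_smul, add_zero] at this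
    exact this.mono_left nhdsWithin_le_nhds
  exact mem_closure_of_tendsto ht h

/-- Moving `d` along `T` times the generic vector moves `S d` along the generic vector, and
non-degeneracy then fails for no small nonzero `t`. -/
theorem dense_nonDegenerate {S T : Matrix (Fin n) (Fin n) ℝ} (hST : S * T = 1) :
    Dense {d : Fin n → ℂ | VecNonDegenerate ⊤ (toC S *ᵥ d)} := by
  intro d
  refine mem_closure_of_eventually_line (e := toC T *ᵥ genericVec n) ?_
  filter_upwards [eventually_nonDegenerate_add_smul_genericVec (toC S *ᵥ d)] with t ht
  rw [Matrix.mulVec_add, Matrix.mulVec_smul, Matrix.mulVec_mulVec, ← toC_mul,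
    hST, toC_one, Matrix.one_mulVec]
  exact ht

theorem dense_re_dotProduct_ne_zero {a : Fin n → ℂ} (ha : a ≠ 0) :
    Dense {d : Fin n → ℂ | (star d ⬝ᵥ a).re ≠ 0} := by
  intro d
  refine mem_closure_of_eventually_line (e := a) ?_
  have h0 : l2 a ^ 2 ≠ 0 := pow_ne_zero 2 fun h => ha (l2_eq_zero.1 h)
  filter_upwards [eventually_quadratic_ne_zero (α := (star d ⬝ᵥ a).re) (β := l2 a ^ 2) (γ := 0)
    (fun h => h0 h.1)] with t ht
  rw [star_add, star_smul, add_dotProduct, smul_dotProduct,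
    star_dotProduct_self, Complex.star_def, Complex.conj_ofReal, smul_eq_mul, Complex.add_re,
    Complex.re_ofReal_mul, Complex.ofReal_re]
  intro h
  refine ht ?_
  linarith

/-- The stereographic parametrization of the sphere of radius `‖a‖` from its point `-a`. -/
noncomputable def stereo (a d : Fin n → ℂ) : Fin n → ℂ :=
  ((2 * (star d ⬝ᵥ a).re / l2 d ^ 2 : ℝ) : ℂ) • d - a

theorem stereo_add (a d : Fin n → ℂ) :
    stereo a d + a = ((2 * (star d ⬝ᵥ a).re / l2 d ^ 2 : ℝ) : ℂ) • d := sub_add_cancel _ _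

theorem l2_stereo (a : Fin n → ℂ) {d : Fin n → ℂ} (hd : d ≠ 0) : l2 (stereo a d) = l2 a := by
  have h := re_star_add_dotProduct_sub (stereo a d) a
  have hd0 : l2 d ^ 2 ≠ 0 := pow_ne_zero 2 fun h => hd (l2_eq_zero.1 h)
  have h1 : stereo a d - a = ((2 * (star d ⬝ᵥ a).re / l2 d ^ 2 : ℝ) : ℂ) • d - (2 : ℂ) • a := by
    unfold stereo
    rw [sub_sub, two_smul]
  rw [stereo_add, h1, star_smul, smul_dotProduct, dotProduct_sub, dotProduct_smul, dotProduct_smul,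
    star_dotProduct_self, Complex.star_def, Complex.conj_ofReal, smul_eq_mul, smul_eq_mul,
    smul_eq_mul, ← Complex.ofReal_mul, div_mul_cancel₀ _ hd0, Complex.re_ofReal_mul,
    Complex.sub_re, Complex.ofReal_re, Complex.mul_re] at h
  simp only [Complex.re_ofNat, Complex.im_ofNat, zero_mul, sub_zero, sub_self, mul_zero] at h
  exact (sq_eq_sq₀ (l2_nonneg _) (l2_nonneg _)).1 (sub_eq_zero.1 h.symm)

theorem exists_stereo_eq {a u : Fin n → ℂ} (ha : a ≠ 0) (h : l2 u = l2 a) :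
    ∃ d ≠ 0, stereo a d = u := by
  by_cases hua : u + a = 0
  -- The centre of projection `-a` itself is reached from tangent directions, those with `Re (dᴴ a)
  -- = 0`.
  · refine ⟨Complex.I • a, smul_ne_zero Complex.I_ne_zero ha, ?_⟩
    unfold stereo
    rw [star_smul, smul_dotProduct, star_dotProduct_self, eq_neg_of_add_eq_zero_left hua]
    simp [-Complex.ofReal_pow]
  · refine ⟨u + a, hua, ?_⟩
    have hd0 : l2 (u + a) ^ 2 ≠ 0 := pow_ne_zero 2 fun h => hua (l2_eq_zero.1 h)
    have h1 := re_star_add_dotProduct_sub u a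
    have h2 : u - a = (u + a) - (2 : ℂ) • a := by rw [two_smul]; abel
    rw [h2, dotProduct_sub, dotProduct_smul, star_dotProduct_self, h, sub_self, Complex.sub_re,
      Complex.ofReal_re, smul_eq_mul, Complex.mul_re] at h1
    simp only [Complex.re_ofNat, Complex.im_ofNat, zero_mul, sub_zero] at h1
    unfold stereo
    rw [← sub_eq_zero.1 h1, div_self hd0, Complex.ofReal_one, one_smul, add_sub_cancel_right]

theorem continuousAt_stereo (a : Fin n → ℂ) {d : Fin n → ℂ} (hd : d ≠ 0) :
    ContinuousAt (stereo a) d := by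
  have hd0 : l2 d ^ 2 ≠ 0 := pow_ne_zero 2 fun h => hd (l2_eq_zero.1 h)
  have h1 : Continuous fun d : Fin n → ℂ => 2 * (star d ⬝ᵥ a).re := by
    unfold dotProduct
    simp only [Pi.star_apply]
    fun_prop
  have h2 : ContinuousAt (fun d : Fin n → ℂ => 2 * (star d ⬝ᵥ a).re / l2 d ^ 2) d :=
    h1.continuousAt.div (continuous_l2.pow 2).continuousAt hd0
  exact ((Complex.continuous_ofReal.continuousAt.comp h2).smul continuousAt_id).sub
    continuousAt_const

/-- On the sphere of radius `‖a‖`, the vectors `u` for which `S (u + a)` is non-degenerate are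
dense. -/
theorem exists_nonDegenerate_near {S T : Matrix (Fin n) (Fin n) ℝ} (hST : S * T = 1)
    {a u : Fin n → ℂ} (ha : a ≠ 0) (h : l2 u = l2 a) {ε : ℝ} (hε : 0 < ε) :
    ∃ u', l2 u' = l2 a ∧ l2 (u - u') < ε ∧ VecNonDegenerate ⊤ (toC S *ᵥ (u' + a)) := by
  obtain ⟨d₀, hd₀, rfl⟩ := exists_stereo_eq ha h
  have hopen : IsOpen {d : Fin n → ℂ | (star d ⬝ᵥ a).re ≠ 0} := by
    refine isOpen_ne_fun ?_ continuous_const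
    unfold dotProduct
    simp only [Pi.star_apply]
    fun_prop
  -- The condition `Re (dᴴ a) ≠ 0` keeps the factor in `stereo_add` nonzero, so that non-degeneracy
  -- passes from `S d` to `S (u' + a)`.
  have hdense := (dense_nonDegenerate hST).inter_of_isOpen_right
    (dense_re_dotProduct_ne_zero ha) hopen
  have hnear : {d | l2 (stereo a d₀ - stereo a d) < ε} ∈ nhds d₀ := (continuousAt_stereo a hd₀).eventually (eventually_l2_sub_lt (stereo a d₀) hε)
  obtain ⟨d, ⟨hd1, hd2⟩, hdn⟩ := hdense.inter_nhds_nonempty hnear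
  rw [Set.mem_ofPred_eq] at hd1 hd2 hdn
  have hd : d ≠ 0 := by
    rintro rfl
    simp at hd2
  have hd0 : l2 d ^ 2 ≠ 0 := pow_ne_zero 2 fun h => hd (l2_eq_zero.1 h)
  refine ⟨stereo a d, l2_stereo a hd, hdn, ?_⟩
  rw [stereo_add, Matrix.mulVec_smul]
  refine hd1.smul ?_
  rw [Complex.ofReal_ne_zero]
  exact div_ne_zero (mul_ne_zero two_ne_zero hd2) hd0

end Density

namespace Network

variable {NT NI NR : ℕ} (net : Network NT NI NR)

theorem exists_config_near {G : SimpleGraph (Fin NI)} (hG : G.Connected) {u a : Fin NI → ℂ}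
    (h : l2 u = l2 a) {ε : ℝ} (hε : 0 < ε) :
    ∃ t ∈ net.configs G, l2 (u - t.Θ *ᵥ a) < ε := by
  by_cases ha : a = 0
  · refine ⟨net.configOf 0, net.configOf_mem ⟨Matrix.transpose_zero, fun _ _ _ _ => rfl⟩, ?_⟩
    rw [ha, l2_zero, l2_eq_zero] at h
    rw [ha, h, Matrix.mulVec_zero, sub_zero, l2_zero]
    exact hε
  · obtain ⟨u', hu', hlt, hnd⟩ := exists_nonDegenerate_near net.invSqrt_mul_inv ha h hε
    obtain ⟨B, hB, hBp⟩ := exists_mem_archSet_of_nonDegenerate hG (hnd.mono le_top)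
      (net.recoveryRhs_compatible hu')
    refine ⟨net.configOf B, net.configOf_mem hB, ?_⟩
    have := (net.eq_barTheta_barB_mulVec_iff hB.1 u' a).2 hBp
    change l2 (u - net.barTheta (net.barB B) *ᵥ a) < ε
    rwa [← this]

/-! ### Receive power maximization -/

theorem channel_mulVec (Θ : Matrix (Fin NI) (Fin NI) ℂ) (w : Fin NT → ℂ) :
    net.channel Θ *ᵥ w = net.HRT *ᵥ w + net.HRI *ᵥ (Θ *ᵥ (net.HIT *ᵥ w)) := by
  unfold channel
  rw [Matrix.add_mulVec, Matrix.mulVec_mulVec, Matrix.mulVec_mulVec, Matrix.mul_assoc]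

theorem relaxObj_eq_l2_channel (Θ : Matrix (Fin NI) (Fin NI) ℂ) (w : Fin NT → ℂ) :
    relaxObj net.HRT net.HRI (w, Θ *ᵥ (net.HIT *ᵥ w)) = l2 (net.channel Θ *ᵥ w) ^ 2 := by
  rw [channel_mulVec]
  rfl

theorem mem_relaxSet_of_mem_configs {G : SimpleGraph (Fin NI)} {t : Config NI}
    (ht : t ∈ net.configs G) {w : Fin NT → ℂ} (hw : l2 w = 1) :
    (w, t.Θ *ᵥ (net.HIT *ᵥ w)) ∈ relaxSet NI net.HIT :=
  ⟨net.l2_config_mulVec ht _, hw⟩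

theorem norm_dotProduct_channel_le {G : SimpleGraph (Fin NI)} {d : Design NT NI NR}
    (hd : d ∈ net.designs G) :
    ‖star d.g ⬝ᵥ (net.channel d.ris.Θ *ᵥ d.w)‖ ≤ l2 (net.channel d.ris.Θ *ᵥ d.w) := by
  have := norm_star_dotProduct_le d.g (net.channel d.ris.Θ *ᵥ d.w)
  rwa [hd.2.2, one_mul] at this

theorem power_le {PT : ℝ} (hPT : 0 < PT) {G : SimpleGraph (Fin NI)} {d : Design NT NI NR}
    (hd : d ∈ net.designs G) :
    net.power PT d ≤
      PT * relaxObj net.HRT net.HRI (d.w, d.ris.Θ *ᵥ (net.HIT *ᵥ d.w)) := by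
  unfold power
  rw [relaxObj_eq_l2_channel]
  exact mul_le_mul_of_nonneg_left
    (pow_le_pow_left₀ (norm_nonneg _) (net.norm_dotProduct_channel_le hd) 2) hPT.le

theorem power_eq_of_norm_eq (PT : ℝ) {d : Design NT NI NR}
    (hd : ‖star d.g ⬝ᵥ (net.channel d.ris.Θ *ᵥ d.w)‖ = l2 (net.channel d.ris.Θ *ᵥ d.w)) :
    net.power PT d = PT * relaxObj net.HRT net.HRI (d.w, d.ris.Θ *ᵥ (net.HIT *ᵥ d.w)) := by
  unfold power
  rw [relaxObj_eq_l2_channel, hd]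

theorem exists_mem_designs (hNR : 0 < NR) (PT : ℝ) {G : SimpleGraph (Fin NI)}
    {t : Config NI} (ht : t ∈ net.configs G) {w : Fin NT → ℂ} (hw : l2 w = 1) :
    ∃ d ∈ net.designs G, d.ris = t ∧ d.w = w ∧
      net.power PT d = PT * relaxObj net.HRT net.HRI (w, t.Θ *ᵥ (net.HIT *ᵥ w)) := by
  have : Nonempty (Fin NR) := ⟨⟨0, hNR⟩⟩
  obtain ⟨g, hg1, hg2⟩ := exists_l2_eq_one_norm_dotProduct_eq (net.channel t.Θ *ᵥ w)
  exact ⟨⟨t, w, g⟩, ⟨ht, hw, hg1⟩, rfl, rfl, net.power_eq_of_norm_eq PT hg2⟩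

/-- Cauchy-Schwarz and the isometry property of `Θ` give the upper bound. It is approached because
`Θ a` comes arbitrarily close to the optimal `u` and the objective is continuous. -/
theorem isLUB_power (hNR : 0 < NR) {PT : ℝ} (hPT : 0 < PT) {G : SimpleGraph (Fin NI)}
    (hG : G.Connected) {p : (Fin NT → ℂ) × (Fin NI → ℂ)}
    (hp : IsOptimal (relaxSet NI net.HIT) (relaxObj net.HRT net.HRI) p) :
    IsLUB (net.power PT '' net.designs G) (PT * relaxObj net.HRT net.HRI p) := by
  obtain ⟨w, u⟩ := p
  constructor
  · rintro _ ⟨d, hd, rfl⟩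
    exact (net.power_le hPT hd).trans (mul_le_mul_of_nonneg_left
      (hp.2 _ (net.mem_relaxSet_of_mem_configs hd.1 hd.2.1)) hPT.le)
  · intro b hb
    refine le_of_forall_pos_lt_add fun η hη => ?_
    have hc : Continuous fun x : EuclideanSpace ℂ (Fin NI) =>
        PT * relaxObj net.HRT net.HRI (w, WithLp.ofLp x) :=
      continuous_const.mul ((continuous_relaxObj _ _).comp
        (continuous_const.prodMk (PiLp.continuous_ofLp 2 _)))
    obtain ⟨δ, hδ, hclose⟩ := Metric.continuousAt_iff.1 (hc.continuousAt (x := WithLp.toLp 2 u)) η hη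
    obtain ⟨t, ht, hlt⟩ := net.exists_config_near hG hp.1.1 hδ
    obtain ⟨d, hd, -, -, hpow⟩ := net.exists_mem_designs hNR PT ht hp.1.2
    have h1 := hclose (x := WithLp.toLp 2 (t.Θ *ᵥ (net.HIT *ᵥ w))) (by
      rw [dist_comm, dist_eq_norm]; exact hlt)
    rw [Real.dist_eq, ← hpow] at h1
    have h2 := (abs_lt.1 h1).1
    have h3 := hb ⟨d, hd, rfl⟩
    linarith

/-- The power is at most `PT ‖H w‖²`, which is at most the supremum. A design is optimal exactly if
both inequalities are equalities. -/
theorem isOptimal_design_iff (hNT : 0 < NT) (hNI : 0 < NI) (hNR : 0 < NR) {PT : ℝ} (hPT : 0 < PT)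
    {G : SimpleGraph (Fin NI)} (hG : G.Connected) {d : Design NT NI NR}
    (hd : d ∈ net.designs G) :
    IsOptimal (net.designs G) (net.power PT) d ↔
      IsOptimal (relaxSet NI net.HIT) (relaxObj net.HRT net.HRI)
          (d.w, d.ris.Θ *ᵥ (net.HIT *ᵥ d.w)) ∧
        ‖star d.g ⬝ᵥ (net.channel d.ris.Θ *ᵥ d.w)‖ = l2 (net.channel d.ris.Θ *ᵥ d.w) := by
  have hmem := net.mem_relaxSet_of_mem_configs hd.1 hd.2.1
  constructor
  · intro hopt
    obtain ⟨p, hp⟩ := exists_isOptimal_relax hNT hNI net.HRT net.HRI net.HIT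
    have h1 : PT * relaxObj net.HRT net.HRI p ≤ net.power PT d :=
      (net.isLUB_power hNR hPT hG hp).2 (by rintro _ ⟨y, hy, rfl⟩; exact hopt.2 y hy)
    have h2 := net.power_le hPT hd
    have h3 := hp.2 _ hmem
    refine ⟨⟨hmem, fun y hy => (hp.2 y hy).trans (le_of_mul_le_mul_left (h1.trans h2) hPT)⟩, ?_⟩
    have h4 : l2 (net.channel d.ris.Θ *ᵥ d.w) ^ 2 ≤
        ‖star d.g ⬝ᵥ (net.channel d.ris.Θ *ᵥ d.w)‖ ^ 2 := by
      rw [← relaxObj_eq_l2_channel]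
      exact h3.trans (le_of_mul_le_mul_left h1 hPT)
    exact le_antisymm (net.norm_dotProduct_channel_le hd)
      ((sq_le_sq₀ (l2_nonneg _) (norm_nonneg _)).1 h4)
  · rintro ⟨hopt, heq⟩
    refine ⟨hd, fun y hy => ?_⟩
    rw [net.power_eq_of_norm_eq PT heq]
    exact (net.isLUB_power hNR hPT hG hopt).1 ⟨y, hy, rfl⟩

theorem exists_isOptimal_of_mem_recovery (hNR : 0 < NR) {PT : ℝ} (hPT : 0 < PT)
    {G : SimpleGraph (Fin NI)} (hG : G.Connected) {w : Fin NT → ℂ} {u : Fin NI → ℂ}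
    (hp : IsOptimal (relaxSet NI net.HIT) (relaxObj net.HRT net.HRI) (w, u)) {t : Config NI}
    (ht : t ∈ net.recovery G w u) : ∃ g : Fin NR → ℂ,
      IsOptimal (net.designs G) (net.power PT) ⟨t, w, g⟩ ∧
        net.power PT ⟨t, w, g⟩ = PT * relaxObj net.HRT net.HRI (w, u) := by
  obtain ⟨htu, htc⟩ := ht
  obtain ⟨⟨_, _, g⟩, hd, rfl, rfl, hpow⟩ := net.exists_mem_designs hNR PT htc hp.1.2
  rw [← htu] at hpow
  refine ⟨g, ⟨hd, fun y hy => ?_⟩, hpow⟩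
  rw [hpow]
  exact (net.isLUB_power hNR hPT hG hp).1 ⟨y, hy, rfl⟩

end Network

end RIS

theorem mainTheorem3 {NT NI NR : ℕ} (hNT : 0 < NT) (hNI : 0 < NI) (hNR : 0 < NR)
    (net : RIS.Network NT NI NR) (PT : ℝ) (hPT : 0 < PT)
    (G : SimpleGraph (Fin NI)) (hG : G = ⊤ ∨ G.IsTree) :
    -- the optimal values of the relaxed problem, of its SDR and of the original problem
    (∃ Pu : ℝ,
      IsGreatest (RIS.relaxObj net.HRT net.HRI '' RIS.relaxSet NI net.HIT) Pu ∧
      IsGreatest (RIS.sdpObj net.HRT net.HRI '' RIS.sdpSet NI net.HIT) Pu ∧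
      IsLUB (net.power PT '' net.designs G) (PT * Pu)) ∧
    -- tightness of the SDR
    RIS.SDRTight net.HRT net.HRI net.HIT ∧
    -- the optimal designs are those that come from optimal solutions of the relaxed problem
    (∀ d ∈ net.designs G,
      RIS.IsOptimal (net.designs G) (net.power PT) d ↔
        RIS.IsOptimal (RIS.relaxSet NI net.HIT) (RIS.relaxObj net.HRT net.HRI)
            (d.w, d.ris.Θ *ᵥ (net.HIT *ᵥ d.w)) ∧
          ‖star d.g ⬝ᵥ (net.channel d.ris.Θ *ᵥ d.w)‖ = RIS.l2 (net.channel d.ris.Θ *ᵥ d.w)) ∧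
    -- a recovered configuration is globally optimal
    (∀ w u, RIS.IsOptimal (RIS.relaxSet NI net.HIT) (RIS.relaxObj net.HRT net.HRI) (w, u) →
      ∀ t ∈ net.recovery G w u, ∃ g : Fin NR → ℂ,
        RIS.IsOptimal (net.designs G) (net.power PT) ⟨t, w, g⟩ ∧
        net.power PT ⟨t, w, g⟩ = PT * RIS.relaxObj net.HRT net.HRI (w, u)) ∧
    -- solvability of the recovery system
    (G.IsTree → ∀ w u, (w, u) ∈ RIS.relaxSet NI net.HIT →
      ((∃! t, t ∈ net.recovery G w u) ↔ net.NonDegenerate G w u)) ∧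
    (G = ⊤ → ∀ w u, (w, u) ∈ RIS.relaxSet NI net.HIT →
      ((∃ t, t ∈ net.recovery G w u) ↔
        ∀ c : ℂ, (∀ i, (c * (u i + (net.HIT *ᵥ w) i)).re = 0) →
          ∀ i, (c * (u i - (net.HIT *ᵥ w) i)).im = 0)) ∧
    (∀ w u, (w, u) ∈ RIS.relaxSet NI net.HIT → ∀ ε > 0,
      ∃ t ∈ net.configs G, RIS.l2 (u - t.Θ *ᵥ (net.HIT *ᵥ w)) < ε) ∧
    -- reduction of the dimension of the SDR to `NT + NR`
    (∀ hRI : NR ≤ NI, ∀ (U : Matrix (Fin NR) (Fin NR) ℂ) (σ : Fin NR → ℝ)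
      (V : Matrix (Fin NI) (Fin NI) ℂ), RIS.IsSVD net.HRI U σ V →
      (∀ w u, RIS.IsOptimal (RIS.relaxSet NI net.HIT) (RIS.relaxObj net.HRT net.HRI) (w, u) ↔
        RIS.IsOptimal (RIS.relaxSet NI net.HIT)
          (RIS.relaxObj (Uᴴ * net.HRT) (RIS.rectDiag σ)) (w, Vᴴ *ᵥ u)) ∧
      (net.HRI ≠ 0 → ∀ (w : Fin NT → ℂ) (v : Fin NI → ℂ),
        RIS.IsOptimal (RIS.relaxSet NI net.HIT)
          (RIS.relaxObj (Uᴴ * net.HRT) (RIS.rectDiag σ)) (w, v) →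
        ∀ i : Fin NI, NR ≤ i.val → v i = 0) ∧
      (∀ (w : Fin NT → ℂ) (v : Fin NR → ℂ),
        RIS.IsOptimal (RIS.relaxSet NR net.HIT)
          (RIS.relaxObj (Uᴴ * net.HRT)
            ((RIS.rectDiag σ : Matrix (Fin NR) (Fin NI) ℂ).submatrix id (Fin.castLE hRI))) (w, v) ↔
        RIS.IsOptimal (RIS.relaxSet NI net.HIT) (RIS.relaxObj net.HRT net.HRI)
          (w, V *ᵥ RIS.zeroPad NI v)) ∧
      RIS.SDRTight (Uᴴ * net.HRT)
        ((RIS.rectDiag σ : Matrix (Fin NR) (Fin NI) ℂ).submatrix id (Fin.castLE hRI)) net.HIT) := by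
  have hconn : G.Connected := by
    have : Nonempty (Fin NI) := ⟨⟨0, hNI⟩⟩
    rcases hG with rfl | h
    · exact SimpleGraph.connected_top
    · exact h.connected
  obtain ⟨p, hp⟩ := RIS.exists_isOptimal_relax hNT hNI net.HRT net.HRI net.HIT
  refine ⟨⟨_, RIS.isGreatest_relaxObj hp, RIS.isGreatest_sdpObj hp, net.isLUB_power hNR hPT hconn hp⟩,
    RIS.sdrTight hNT hNI _ _ _, fun d hd => net.isOptimal_design_iff hNT hNI hNR hPT hconn hd,
    fun w u hwu t ht => net.exists_isOptimal_of_mem_recovery hNR hPT hconn hwu ht,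
    fun hT w u hwu => net.existsUnique_recovery_iff hT hwu, ?_,
    fun w u hwu ε hε => net.exists_config_near hconn hwu.1 hε, ?_⟩
  · rintro rfl w u hwu
    exact net.exists_recovery_top_iff hwu
  · intro hRI U σ V hs
    refine ⟨fun w u => hs.isOptimal_iff w u, fun hne w v hv i hi => ?_,
      fun w v => hs.isOptimal_zeroPad_iff hRI hNR w v, RIS.sdrTight hNT hNR _ _ _⟩
    obtain ⟨i₀, hi₀⟩ := hs.pos_of_ne_zero hne
    exact RIS.tail_eq_zero_of_isOptimal hRI hi₀ hv hi
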